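/- **Conventions.** Let $d\in\mathbb N$. For $z=(x,\xi)\in\mathbb R^{2d}$ put $\langle z\rangle=(1+|z|^2)^{1/2}$ and let $\pi(z)f(t)=e^{2\pi i\xi\cdot t}f(t-x)$ be the time-frequency shift. For $f,g\in\mathcal S(\mathbb R^d)$ let $$W(f,g)(x,\xi)=\int_{\mathbb R^d} f\big(x+\tfrac t2\big)\,\overline{g\big(x-\tfrac t2\big)}\,e^{-2\pi i t\cdot\xi}\,dt$$ be the Wigner distribution. For $\sigma\in\mathcal S'(\mathbb R^{2d})$ the Weyl transform $\sigma^w$ is defined by $\langle\sigma^w f,g\rangle=\langle\sigma,W(g,f)\rangle$ for $f,g\in\mathcal S(\mathbb R^d)$, where the duality $\langle\cdot,\cdot\rangle$ is antilinear in the second entry and extends the $L^2$ inner product. The Hörmander class $S^0_{0,0}(\mathbb R^{2d})$ is the set of $C^\infty$ functions on $\mathbb R^{2d}$ all of whose partial derivatives (of every order, including order $0$) are bounded; its elements are regarded as tempered distributions. **Theorem.** Let $\Lambda\subset\mathbb R^{2d}$ be a lattice (a discrete subgroup that spans $\mathbb R^{2d}$) and let $g\in\mathcal S(\mathbb R^d)$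 be such that $\{\pi(\lambda)g:\lambda\in\Lambda\}$ is a tight Gabor frame for $L^2(\mathbb R^d)$ (with constant $1$), that is, $\|f\|_2^2=\sum_{\lambda\in\Lambda}|\langle f,\pi(\lambda)g\rangle|^2$ for all $f\in L^2(\mathbb R^d)$. Then for every $\sigma\in\mathcal S'(\mathbb R^{2d})$ the following are equivalent: 1. $\sigma\in S^0_{0,0}(\mathbb R^{2d})$. 2. For every $s\ge 0$ there is a constant $C_s$ such that $|\langle\sigma^w\pi(z)g,\pi(w)g\rangle|\le C_s\langle w-z\rangle^{-s}$ for all $z,w\in\mathbb R^{2d}$. 3. For every $s\ge 0$ there is a constant $C_s$ such that $|\langle\sigma^w\pi(\mu)g,\pi(\lambda)g\rangle|\le C_s\langle\lambda-\mu\rangle^{-s}$ for all $\lambda,\mu\in\Lambda$. -/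

import Mathlib

open scoped SchwartzMap FourierTransform ContDiff
open MeasureTheory

namespace GaborWeyl
noncomputable section

set_option linter.unusedSectionVars false

section PartialFourier

variable {E : Type} [NormedAddCommGroup E] [InnerProductSpace ℝ E] [FiniteDimensional ℝ E]
  [MeasurableSpace E] [BorelSpace E]
variable {V : Type} [NormedAddCommGroup V] [NormedSpace ℂ V]

/-- The partial Fourier transform `(x, ξ) ↦ ∫ F(x, t) e^{-2πi t·ξ} dt`. -/
def partialFourier (F : 𝓢(E × E, V)) (z : E × E) : V :=
  𝓕 (fun t : E => F (z.1, t)) z.2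

theorem exists_section_bound (F : 𝓢(E × E, V)) (k : ℕ) :
    ∃ b : E → ℝ, Integrable b ∧ ∀ x t : E, ‖x‖ ^ k * ‖F (x, t)‖ ≤ b t := by
  set m := (volume : Measure E).integrablePower
  set C := 2 ^ (k + m) * ((Finset.Iic (k + m, 0)).sup
    (fun p => SchwartzMap.seminorm ℝ p.1 p.2) F)
  refine ⟨fun t => (1 + ‖t‖) ^ (-(m : ℝ)) * C,
    (Measure.integrable_pow_neg_integrablePower volume).mul_const _, fun x t => ?_⟩
  have h := SchwartzMap.one_add_le_sup_seminorm_apply (𝕜 := ℝ) (m := (k + m, 0)) (k := k + m)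
    (n := 0) le_rfl le_rfl F (x, t)
  rw [norm_iteratedFDeriv_zero] at h
  beta_reduce
  rw [Real.rpow_neg (by positivity), Real.rpow_natCast, ← div_eq_inv_mul,
    le_div_iff₀' (by positivity)]
  refine le_trans ?_ h
  have h1 : ‖x‖ ≤ 1 + ‖(x, t)‖ := (norm_fst_le (x, t)).trans (by linarith)
  have h2 : 1 + ‖t‖ ≤ 1 + ‖(x, t)‖ := by linarith [norm_snd_le (x, t)]
  rw [pow_add, ← mul_assoc, mul_comm ((1 + ‖t‖) ^ m)]
  gcongr

theorem integrable_section (F : 𝓢(E × E, V)) (x : E) :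
    Integrable (fun t : E => F (x, t)) := by
  obtain ⟨b, hb, h⟩ := exists_section_bound F 0
  refine hb.mono' (by fun_prop) (Filter.Eventually.of_forall fun t => ?_)
  simpa using h x t

/-- The partial derivative in the second variable. -/
def fderivSnd (F : 𝓢(E × E, V)) : 𝓢(E × E, E →L[ℝ] V) :=
  SchwartzMap.postcompCLM (𝕜 := ℝ)
    ((ContinuousLinearMap.compL ℝ E (E × E) V).flip (ContinuousLinearMap.inr ℝ E E))
    (SchwartzMap.fderivCLM ℝ (E × E) V F)

theorem hasFDerivAt_section (F : 𝓢(E × E, V)) (x t : E) :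
    HasFDerivAt (fun t : E => F (x, t)) (fderivSnd F (x, t)) t :=
  (F.hasFDerivAt (x, t)).comp t (hasFDerivAt_prodMk_right x t)

theorem norm_mul_partialFourier (F : 𝓢(E × E, V)) (x ξ : E) :
    ‖ξ‖ * ‖partialFourier F (x, ξ)‖ ≤ ‖partialFourier (fderivSnd F) (x, ξ)‖ := by
  have hd : fderiv ℝ (fun t : E => F (x, t)) = fun t => fderivSnd F (x, t) :=
    funext fun t => (hasFDerivAt_section F x t).fderiv
  have h := Real.fourier_fderiv (integrable_section F x)
    (fun t => (hasFDerivAt_section F x t).differentiableAt)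
    (by rw [hd]; exact integrable_section (fderivSnd F) x)
  rw [hd] at h
  have h' := congrFun h ξ
  unfold partialFourier
  simp only
  rw [h']
  set A := 𝓕 (fun t => F (x, t)) ξ with hA
  rcases eq_or_ne ξ 0 with rfl | hξ
  · simp
  have hpos : 0 < ‖ξ‖ := norm_pos_iff.2 hξ
  have h1 := (VectorFourier.fourierSMulRight (-innerSL ℝ) (𝓕 fun t => F (x, t)) ξ).le_opNorm ξ
  rw [VectorFourier.fourierSMulRight_apply, ← hA, norm_smul, norm_smul] at h1
  simp only [neg_apply, innerSL_apply_apply ℝ, real_inner_self_eq_norm_sq, norm_neg,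
    norm_mul, Complex.norm_ofNat, Complex.norm_real, Complex.norm_I, mul_one, Real.norm_eq_abs,
    abs_of_pos Real.pi_pos, abs_pow, abs_norm] at h1
  have hpi : (1 : ℝ) ≤ 2 * Real.pi := by linarith [Real.pi_gt_three]
  refine le_of_mul_le_mul_right (le_trans ?_ h1) hpos
  have h2 : 0 ≤ ‖ξ‖ ^ 2 * ‖A‖ := by positivity
  nlinarith

theorem exists_partialFourier_bound (k l : ℕ) : ∀ {V : Type} [NormedAddCommGroup V]
    [NormedSpace ℂ V] (F : 𝓢(E × E, V)), ∃ C : ℝ, ∀ x ξ : E,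
      ‖x‖ ^ k * (‖ξ‖ ^ l * ‖partialFourier F (x, ξ)‖) ≤ C := by
  induction l with
  | zero =>
    intro V _ _ F
    obtain ⟨b, hb, h⟩ := exists_section_bound F k
    refine ⟨∫ t, b t, fun x ξ => ?_⟩
    have h1 : ‖partialFourier F (x, ξ)‖ ≤ ∫ t, ‖F (x, t)‖ := by
      unfold partialFourier
      rw [Real.fourier_eq]
      refine (norm_integral_le_integral_norm _).trans_eq ?_
      simp
    calc _ ≤ ‖x‖ ^ k * ∫ t, ‖F (x, t)‖ := by
          rw [pow_zero, one_mul]; gcongr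
      _ = ∫ t, ‖x‖ ^ k * ‖F (x, t)‖ := (integral_const_mul _ _).symm
      _ ≤ _ := integral_mono ((integrable_section F x).norm.const_mul _) hb (h x)
  | succ l ih =>
    intro V _ _ F
    obtain ⟨C, h⟩ := ih (fderivSnd F)
    refine ⟨C, fun x ξ => le_trans ?_ (h x ξ)⟩
    rw [pow_succ, mul_assoc (‖ξ‖ ^ l)]
    gcongr
    exact norm_mul_partialFourier F x ξ

theorem exists_partialFourier_decay (k : ℕ) (F : 𝓢(E × E, V)) :
    ∃ C : ℝ, ∀ z : E × E, ‖z‖ ^ k * ‖partialFourier F z‖ ≤ C := by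
  obtain ⟨C₁, h₁⟩ := exists_partialFourier_bound k 0 F
  obtain ⟨C₂, h₂⟩ := exists_partialFourier_bound 0 k F
  refine ⟨C₁ + C₂, fun z => ?_⟩
  have e₁ := h₁ z.1 z.2
  have e₂ := h₂ z.1 z.2
  simp only [pow_zero, one_mul, Prod.mk.eta] at e₁ e₂
  have p₁ : 0 ≤ ‖z.1‖ ^ k * ‖partialFourier F z‖ := by positivity
  have p₂ : 0 ≤ ‖z.2‖ ^ k * ‖partialFourier F z‖ := by positivity
  rcases max_choice ‖z.1‖ ‖z.2‖ with h | h <;> rw [Prod.norm_def, h] <;> linarith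

/-- The Schwartz function whose partial Fourier transform is the derivative of the partial
Fourier transform of `F`. -/
def fderivPartial (F : 𝓢(E × E, V)) : 𝓢(E × E, E × E →L[ℝ] V) :=
  SchwartzMap.postcompCLM (𝕜 := ℝ)
    ((ContinuousLinearMap.compL ℝ (E × E) (E × E) V).flip
      ((ContinuousLinearMap.inl ℝ E E).comp (ContinuousLinearMap.fst ℝ E E)))
    (SchwartzMap.fderivCLM ℝ (E × E) V F)
  + (-(2 * Real.pi * Complex.I) : ℂ) • SchwartzMap.smulRightCLM ℂ V
    (((ContinuousLinearMap.compL ℝ (E × E) E ℝ).flip (ContinuousLinearMap.snd ℝ E E)).comp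
      ((innerSL ℝ).comp (ContinuousLinearMap.snd ℝ E E))) F

theorem fderivPartial_apply (F : 𝓢(E × E, V)) (x t : E) (v : E × E) :
    fderivPartial F (x, t) v = fderiv ℝ F (x, t) (v.1, 0)
      - ((2 * Real.pi * Complex.I : ℂ) * ((inner ℝ t v.2 : ℝ) : ℂ)) • F (x, t) := by
  change fderiv ℝ F (x, t) (v.1, 0)
      + (-(2 * Real.pi * Complex.I) : ℂ) • ((inner ℝ t v.2 : ℝ) • F (x, t)) = _
  rw [← Complex.coe_smul, smul_smul, neg_mul, neg_smul, sub_eq_add_neg]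

theorem circle_smul_apply (c : Circle) (L : E × E →L[ℝ] V) (v : E × E) :
    (c • L) v = (c : ℂ) • L v := rfl

theorem hasFDerivAt_partialFourier (F : 𝓢(E × E, V)) (z : E × E) :
    HasFDerivAt (partialFourier F) (partialFourier (V := E × E →L[ℝ] V) (fderivPartial F) z) z := by
  obtain ⟨b, hb, h⟩ := exists_section_bound (V := E × E →L[ℝ] V) (fderivPartial F) 0
  simp only [pow_zero, one_mul] at h
  unfold partialFourier
  simp only [Real.fourier_eq]
  refine hasFDerivAt_integral_of_dominated_of_fderiv_le (bound := b) (𝕜 := ℝ)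
    (F := fun (z : E × E) (t : E) => Real.fourierChar (-inner ℝ t z.2) • F (z.1, t))
    (F' := fun (z : E × E) (t : E) => Real.fourierChar (-inner ℝ t z.2) • fderivPartial F (z.1, t))
    Filter.univ_mem
    (Filter.Eventually.of_forall fun w => ?_) ?_ ?_ ?_ hb ?_
  · exact Continuous.aestronglyMeasurable (by fun_prop)
  · have := (Real.fourierIntegral_convergent_iff (μ := volume) (f := fun t : E => F (z.1, t)) z.2).2 (integrable_section F z.1)
    exact this
  · exact Continuous.aestronglyMeasurable (by fun_prop)
  · exact Filter.Eventually.of_forall fun t w _ => by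
      rw [Circle.smul_def, norm_smul, Circle.norm_coe, one_mul]
      exact h w.1 t
  · refine Filter.Eventually.of_forall fun t w _ => ?_
    have h1 := (F.hasFDerivAt (w.1, t)).comp w
      ((hasFDerivAt_fst (𝕜 := ℝ) (p := w)).prodMk (hasFDerivAt_const t w))
    have h2 := (Real.hasFDerivAt_fourierChar_neg_bilinear_right (innerSL ℝ) t w.2).comp w
      (hasFDerivAt_snd (𝕜 := ℝ) (p := w))
    have h3 := h2.smul h1
    refine h3.congr_fderiv ?_
    refine ContinuousLinearMap.ext fun v => ?_
    rw [circle_smul_apply, fderivPartial_apply]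
    simp [smul_smul, sub_eq_add_neg, innerSL_apply_apply ℝ]
    ring_nf

theorem contDiff_partialFourier (n : ℕ) : ∀ {V : Type} [NormedAddCommGroup V]
    [NormedSpace ℂ V] (F : 𝓢(E × E, V)), ContDiff ℝ n (partialFourier F) := by
  induction n with
  | zero =>
    intro V _ _ F
    exact contDiff_zero.2 (continuous_iff_continuousAt.2
      fun z => (hasFDerivAt_partialFourier F z).continuousAt)
  | succ n ih =>
    intro V _ _ F
    have : fderiv ℝ (partialFourier F) = partialFourier (V := E × E →L[ℝ] V) (fderivPartial F) :=
      funext fun z => (hasFDerivAt_partialFourier F z).fderiv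
    push_cast
    rw [contDiff_succ_iff_fderiv, this]
    exact ⟨fun z => (hasFDerivAt_partialFourier F z).differentiableAt, by simp,
      ih (V := E × E →L[ℝ] V) (fderivPartial F)⟩

theorem decay_partialFourier (k n : ℕ) : ∀ {V : Type} [NormedAddCommGroup V]
    [NormedSpace ℂ V] (F : 𝓢(E × E, V)), ∃ C : ℝ, ∀ z : E × E,
      ‖z‖ ^ k * ‖iteratedFDeriv ℝ n (partialFourier F) z‖ ≤ C := by
  induction n with
  | zero =>
    intro V _ _ F
    simpa only [norm_iteratedFDeriv_zero] using exists_partialFourier_decay k F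
  | succ n ih =>
    intro V _ _ F
    have : fderiv ℝ (partialFourier F) = partialFourier (V := E × E →L[ℝ] V) (fderivPartial F) :=
      funext fun z => (hasFDerivAt_partialFourier F z).fderiv
    obtain ⟨C, hC⟩ := ih (V := E × E →L[ℝ] V) (fderivPartial F)
    refine ⟨C, fun z => ?_⟩
    rw [← norm_iteratedFDeriv_fderiv, this]
    exact hC z

end PartialFourier

variable {E : Type} [NormedAddCommGroup E] [InnerProductSpace ℝ E] [FiniteDimensional ℝ E]
  [MeasurableSpace E] [BorelSpace E]

theorem norm_iteratedFDeriv_comp_le_of_norm_le_one {E V : Type} [NormedAddCommGroup E] [NormedSpace ℝ E] [NormedAddCommGroup V] [NormedSpace ℝ V] {D : Type}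
    [NormedAddCommGroup D] [NormedSpace ℝ D] (f : 𝓢(E, V)) (L : D →L[ℝ] E) (hL : ‖L‖ ≤ 1)
    (n : ℕ) (z : D) : ‖iteratedFDeriv ℝ n (fun z => f (L z)) z‖ ≤ ‖iteratedFDeriv ℝ n f (L z)‖ := by
  have := L.iteratedFDeriv_comp_right (f.smooth ⊤) z (i := n) (mod_cast le_top)
  simp only [Function.comp_def] at this
  rw [this]
  refine (ContinuousMultilinearMap.norm_compContinuousLinearMap_le _ _).trans ?_
  refine mul_le_of_le_one_right (norm_nonneg _) ?_
  exact Finset.prod_le_one (fun _ _ => norm_nonneg _) fun _ _ => hL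

/-- The tensor product `(x, y) ↦ f x * g y` of two Schwartz functions. -/
def tensor (f g : 𝓢(E, ℂ)) : 𝓢(E × E, ℂ) where
  toFun z := f z.1 * g z.2
  smooth' := ((f.smooth ⊤).comp contDiff_fst).mul ((g.smooth ⊤).comp contDiff_snd)
  decay' k n := by
    refine ⟨∑ i ∈ Finset.range (n + 1), (n.choose i : ℝ) *
      (SchwartzMap.seminorm ℝ k i f * SchwartzMap.seminorm ℝ 0 (n - i) g
        + SchwartzMap.seminorm ℝ 0 i f * SchwartzMap.seminorm ℝ k (n - i) g), fun z => ?_⟩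
    have h := norm_iteratedFDeriv_mul_le (𝕜 := ℝ) (N := ∞)
      ((f.smooth ⊤).comp (contDiff_fst (𝕜 := ℝ) (E := E) (F := E)))
      ((g.smooth ⊤).comp (contDiff_snd (𝕜 := ℝ) (E := E) (F := E))) z (n := n) (mod_cast le_top)
    refine (mul_le_mul_of_nonneg_left h (by positivity)).trans ?_
    rw [Finset.mul_sum]
    refine Finset.sum_le_sum fun i _ => ?_
    have a := norm_iteratedFDeriv_comp_le_of_norm_le_one f (ContinuousLinearMap.fst ℝ E E)
      (ContinuousLinearMap.norm_fst_le ℝ E E) i z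
    have b := norm_iteratedFDeriv_comp_le_of_norm_le_one g (ContinuousLinearMap.snd ℝ E E)
      (ContinuousLinearMap.norm_snd_le ℝ E E) (n - i) z
    simp only [ContinuousLinearMap.coe_fst', ContinuousLinearMap.coe_snd'] at a b
    simp only [Function.comp_def]
    set A := ‖iteratedFDeriv ℝ i f z.1‖
    set B := ‖iteratedFDeriv ℝ (n - i) g z.2‖
    have a0 : A ≤ SchwartzMap.seminorm ℝ 0 i f := f.norm_iteratedFDeriv_le_seminorm ℝ i z.1
    have b0 : B ≤ SchwartzMap.seminorm ℝ 0 (n - i) g :=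
      g.norm_iteratedFDeriv_le_seminorm ℝ (n - i) z.2
    have ak : ‖z.1‖ ^ k * A ≤ SchwartzMap.seminorm ℝ k i f := f.le_seminorm ℝ k i z.1
    have bk : ‖z.2‖ ^ k * B ≤ SchwartzMap.seminorm ℝ k (n - i) g := g.le_seminorm ℝ k (n - i) z.2
    have hz : ‖z‖ ^ k ≤ ‖z.1‖ ^ k + ‖z.2‖ ^ k := by
      have p₁ : 0 ≤ ‖z.1‖ ^ k := by positivity
      have p₂ : 0 ≤ ‖z.2‖ ^ k := by positivity
      rcases max_choice ‖z.1‖ ‖z.2‖ with h | h <;> rw [Prod.norm_def, h] <;> linarith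
    have hA : 0 ≤ A := norm_nonneg _
    have hB : 0 ≤ B := norm_nonneg _
    calc _ ≤ ‖z‖ ^ k * (n.choose i * A * B) := by gcongr
      _ ≤ (‖z.1‖ ^ k + ‖z.2‖ ^ k) * (n.choose i * A * B) := by gcongr
      _ = n.choose i * ((‖z.1‖ ^ k * A) * B + A * (‖z.2‖ ^ k * B)) := by ring
      _ ≤ _ := by gcongr

/-- Complex conjugation of Schwartz functions. -/
def conj {D : Type} [NormedAddCommGroup D] [NormedSpace ℝ D] (f : 𝓢(D, ℂ)) : 𝓢(D, ℂ) :=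
  SchwartzMap.postcompCLM (𝕜 := ℝ) (Complex.conjCLE : ℂ →L[ℝ] ℂ) f

@[simp] theorem conj_apply {D : Type} [NormedAddCommGroup D] [NormedSpace ℝ D] (f : 𝓢(D, ℂ))
    (x : D) : conj f x = starRingEnd ℂ (f x) := rfl

/-- The linear change of variables `(x, t) ↦ (x + t / 2, x - t / 2)`. -/
def wignerEquiv : (E × E) ≃L[ℝ] (E × E) :=
  LinearEquiv.toContinuousLinearEquiv
    { toFun := fun z => (z.1 + (1 / 2 : ℝ) • z.2, z.1 - (1 / 2 : ℝ) • z.2)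
      invFun := fun z => ((1 / 2 : ℝ) • (z.1 + z.2), z.1 - z.2)
      map_add' := fun z w => by ext <;> simp <;> module
      map_smul' := fun c z => by ext <;> simp <;> module
      left_inv := fun z => by ext <;> simp <;> module
      right_inv := fun z => by ext <;> simp <;> module }

/-- The Wigner distribution
`W(f, g)(x, ξ) = ∫ f(x + t/2) conj(g(x - t/2)) e^{-2πi t·ξ} dt`, where `z = (x, ξ)`. -/
def wignerFun (f g : 𝓢(E, ℂ)) (z : E × E) : ℂ :=
  ∫ t : E, f (z.1 + (1 / 2 : ℝ) • t) * starRingEnd ℂ (g (z.1 - (1 / 2 : ℝ) • t))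
    * Complex.exp (-(2 * Real.pi * Complex.I * (inner ℝ t z.2 : ℝ)))

theorem wignerFun_eq (f g : 𝓢(E, ℂ)) : wignerFun f g = partialFourier
    (SchwartzMap.compCLMOfContinuousLinearEquiv ℂ wignerEquiv (tensor f (conj g))) := by
  funext z
  unfold wignerFun partialFourier
  rw [Real.fourier_eq]
  congr 1
  funext t
  rw [Circle.smul_def, Real.fourierChar_apply, smul_eq_mul, mul_comm]
  congr 1
  congr 1
  push_cast
  ring

/-- The Wigner distribution of two Schwartz functions is a Schwartz function. -/
def wigner (f g : 𝓢(E, ℂ)) : 𝓢(E × E, ℂ) where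
  toFun := wignerFun f g
  smooth' := by
    rw [wignerFun_eq]
    exact contDiff_infty.2 fun n => contDiff_partialFourier n _
  decay' k n := by
    rw [wignerFun_eq]
    exact decay_partialFourier k n _

theorem wigner_apply (f g : 𝓢(E, ℂ)) (z : E × E) : wigner f g z = wignerFun f g z := rfl

theorem hasTemperateGrowth_modulation (ξ : E) :
    (fun t : E => Complex.exp (2 * Real.pi * Complex.I * (inner ℝ ξ t : ℝ))).HasTemperateGrowth := by
  have h : (fun s : ℝ => Complex.exp (2 * Real.pi * Complex.I * s)).HasTemperateGrowth := by
    refine ⟨(contDiff_const.mul Complex.ofRealCLM.contDiff).cexp, fun n => ⟨0, (2 * Real.pi) ^ n, fun s => ?_⟩⟩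
    rw [norm_iteratedFDeriv_eq_norm_iteratedDeriv]
    have : iteratedDeriv n (fun s : ℝ => Complex.exp (2 * Real.pi * Complex.I * s))
      = fun s : ℝ => (2 * Real.pi * Complex.I) ^ n * Complex.exp (2 * Real.pi * Complex.I * s) := by
      induction n with
      | zero => simp
      | succ n ih =>
        rw [iteratedDeriv_succ, ih]
        funext s
        have h1 : HasDerivAt (fun s : ℝ => 2 * Real.pi * Complex.I * (s : ℂ)) (2 * Real.pi * Complex.I) s := by
          simpa using (Complex.ofRealCLM.hasDerivAt (x := s)).const_mul (2 * Real.pi * Complex.I)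
        rw [(h1.cexp.const_mul _).deriv]
        ring
    rw [this]
    have h2 : (2 * Real.pi * Complex.I * s : ℂ) = ((2 * Real.pi * s : ℝ) : ℂ) * Complex.I := by
      push_cast; ring
    rw [norm_mul, h2, Complex.norm_exp_ofReal_mul_I]
    simp [abs_of_pos Real.pi_pos]
  exact h.comp (by fun_prop : (fun t : E => inner ℝ ξ t).HasTemperateGrowth)

/-- The time-frequency shift `π(z) f (t) = e^{2πi ξ·t} f(t - x)`, where `z = (x, ξ)`. -/
def timeFreqShift (z : E × E) (f : 𝓢(E, ℂ)) : 𝓢(E, ℂ) :=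
  SchwartzMap.smulLeftCLM ℂ
    (fun t : E => Complex.exp (2 * Real.pi * Complex.I * (inner ℝ z.2 t : ℝ)))
    (SchwartzMap.compSubConstCLM ℂ z.1 f)

theorem timeFreqShift_apply (z : E × E) (f : 𝓢(E, ℂ)) (t : E) :
    timeFreqShift z f t =
      Complex.exp (2 * Real.pi * Complex.I * (inner ℝ z.2 t : ℝ)) * f (t - z.1) := by
  simp [timeFreqShift, hasTemperateGrowth_modulation]

/-- The sesquilinear duality `⟨σ, Φ⟩` of tempered distributions and Schwartz functions, extending
`∫ σ conj(Φ)`. A `TemperedDistribution` acts linearly on test functions. -/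
def sesqPairing (σ : 𝓢'(E × E, ℂ)) (Φ : 𝓢(E × E, ℂ)) : ℂ := σ (conj Φ)

/-- The form `⟨σ^w f, g⟩ = ⟨σ, W(g, f)⟩` that defines the Weyl transform `σ^w`. -/
def weylForm (σ : 𝓢'(E × E, ℂ)) (f g : 𝓢(E, ℂ)) : ℂ := sesqPairing σ (wigner g f)

/-- The bracket `⟨z⟩ = (1 + |z|^2)^{1/2}`, with the Euclidean norm of `z = (x, ξ)`. -/
def bracket (z : E × E) : ℝ := Real.sqrt (1 + (‖z.1‖ ^ 2 + ‖z.2‖ ^ 2))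

/-- The family `π(l) g`, for `l` in `Λ`, is a tight Gabor frame (with constant 1) for `L²`. -/
def IsTightGaborFrame (g : 𝓢(E, ℂ)) (Λ : Submodule ℤ (E × E)) : Prop :=
  ∀ f : Lp ℂ 2 (volume : Measure E),
    HasSum (fun l : Λ => ‖inner ℂ ((timeFreqShift (l : E × E) g).toLp 2) f‖ ^ 2) (‖f‖ ^ 2)

/-- Smooth functions all of whose derivatives are bounded. -/
def IsHormanderFun (a : E × E → ℂ) : Prop :=
  ContDiff ℝ ∞ a ∧ ∀ n : ℕ, ∃ C : ℝ, ∀ z, ‖iteratedFDeriv ℝ n a z‖ ≤ C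

theorem IsHormanderFun.hasTemperateGrowth {a : E × E → ℂ} (ha : IsHormanderFun a) :
    a.HasTemperateGrowth :=
  ⟨ha.1, fun n => ⟨0, by simpa using ha.2 n⟩⟩

instance instVolumeProdHasTemperateGrowth : (volume : Measure (E × E)).HasTemperateGrowth := by
  rw [Measure.volume_eq_prod]
  infer_instance

/-- The tempered distribution `σ` is (integration against) a function of the Hörmander class
`S^0_{0,0}`. -/
def IsHormanderSymbol (σ : 𝓢'(E × E, ℂ)) : Prop :=
  ∃ (a : E × E → ℂ) (ha : IsHormanderFun a),
    σ = Function.HasTemperateGrowth.toTemperedDistribution volume ha.hasTemperateGrowth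

end

end GaborWeyl

/-! An entry of the Gabor matrix is σ applied to the conjugate of the atom W(π(w)g, π(z)g). By
covariance (`wigner_timeFreqShift`) this atom is, up to a unimodular factor, W(g,g) translated to
the midpoint (w+z)/2 and modulated with a frequency that is a symplectic rotation of w-z. Every
estimate rests on this picture.

From 1 to 2: if σ is a function a, the modulus of an entry is that of a symplectic Fourier transform
at w-z of a times a translate of the conjugate of W(g,g). Since a has bounded derivatives,
integration by parts gives decay of any order in w-z, uniformly in the translate
(`exists_oscillatory_decay`). Statement 3 is a restriction of 2.

From 3 to 1: tensoring the Gabor frame with its conjugate gives a tight frame identity in 2d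
variables. The Wigner map is a bijection of Schwartz functions that preserves the L² inner product
and takes these tensors to atoms, so the lattice atoms satisfy a tight frame identity on phase space
(`IsTightGaborFrame.hasSum_atom`). The coefficients of a Schwartz function decay rapidly, so its
atomic expansion converges in the Schwartz topology (`IsTightGaborFrame.hasSum_schwartz_atom`) and σ
may be applied term by term. Hence σ is integration against the sum over (λ,μ) of the Gabor matrix
entry times the atom. An n-th derivative of an atom costs a factor (1+|λ-μ|)^n, which the
off-diagonal decay absorbs; concentration at the midpoint then bounds the sum uniformly in u
(`isHormanderFun_gaborSymbol`). -/

namespace GaborWeyl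

set_option linter.unusedSectionVars false

/-! ### Termwise differentiation of series and convergence in the Schwartz space. -/

section SmoothSeries

variable {V : Type} [NormedAddCommGroup V] [NormedSpace ℝ V] {ι : Type}

/-- The derivatives of order `n` of the functions `f i` are dominated by a summable sequence,
locally uniformly. -/
def HasLocalSummableBound {F : Type} [NormedAddCommGroup F] [NormedSpace ℝ F]
    (f : ι → V → F) (n : ℕ) : Prop :=
  ∀ u₀ : V, ∃ v : ι → ℝ, Summable v ∧
    ∀ i, ∀ u ∈ Metric.ball u₀ 1, ‖iteratedFDeriv ℝ n (f i) u‖ ≤ v i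

theorem HasLocalSummableBound.summable {F : Type} [NormedAddCommGroup F] [NormedSpace ℝ F]
    {f : ι → V → F} {n : ℕ} (h : HasLocalSummableBound f n) (u : V) :
    Summable fun i => ‖iteratedFDeriv ℝ n (f i) u‖ := by
  obtain ⟨v, hv, h⟩ := h u
  exact hv.of_nonneg_of_le (fun _ => norm_nonneg _) fun i => h i u (Metric.mem_ball_self one_pos)

theorem hasFDerivAt_tsum_of_hasLocalSummableBound {F : Type} [NormedAddCommGroup F]
    [NormedSpace ℝ F] [CompleteSpace F] {f : ι → V → F} (hf : ∀ i, ContDiff ℝ ∞ (f i))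
    (h0 : HasLocalSummableBound f 0) (h1 : HasLocalSummableBound f 1) (u : V) :
    HasFDerivAt (fun u => ∑' i, f i u) (∑' i, fderiv ℝ (f i) u) u := by
  obtain ⟨v, hv, hb⟩ := h1 u
  refine hasFDerivAt_tsum_of_isPreconnected hv Metric.isOpen_ball
    (convex_ball u 1).isPreconnected
    (fun i x _ => ((hf i).differentiable (by simp) x).hasFDerivAt) (fun i x hx => ?_)
    (Metric.mem_ball_self one_pos) (x₀ := u) ?_ (Metric.mem_ball_self one_pos)
  · rw [← norm_iteratedFDeriv_one]
    exact hb i x hx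
  · exact .of_norm (by simpa using h0.summable u)

/-- Induction on the order, with the target space `F` free: the step passes to the derivatives
`fderiv ℝ (f i)`, which take values in another space and inherit the summable bounds with the order
shifted by one. -/
theorem contDiff_tsum_of_hasLocalSummableBound (n : ℕ) : ∀ {F : Type} [NormedAddCommGroup F]
    [NormedSpace ℝ F] [CompleteSpace F] {f : ι → V → F}, (∀ i, ContDiff ℝ ∞ (f i)) →
    (∀ m, HasLocalSummableBound f m) → ContDiff ℝ n (fun u => ∑' i, f i u) ∧
      ∀ u, ‖iteratedFDeriv ℝ n (fun u => ∑' i, f i u) u‖ ≤ ∑' i, ‖iteratedFDeriv ℝ n (f i) u‖ := by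
  induction n with
  | zero =>
    intro F _ _ _ f hf h
    refine ⟨contDiff_zero.2 (continuous_iff_continuousAt.2
      fun u => (hasFDerivAt_tsum_of_hasLocalSummableBound hf (h 0) (h 1) u).continuousAt),
      fun u => ?_⟩
    simp only [norm_iteratedFDeriv_zero]
    exact norm_tsum_le_tsum_norm (by simpa using (h 0).summable u)
  | succ n ih =>
    intro F _ _ _ f hf h
    have hd : fderiv ℝ (fun u => ∑' i, f i u) = fun u => ∑' i, fderiv ℝ (f i) u :=
      funext fun u => (hasFDerivAt_tsum_of_hasLocalSummableBound hf (h 0) (h 1) u).fderiv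
    obtain ⟨h₁, h₂⟩ := ih (f := fun i => fderiv ℝ (f i))
      (fun i => (hf i).fderiv_right (by simp)) fun m u₀ => by
        obtain ⟨v, hv, hb⟩ := h (m + 1) u₀
        exact ⟨v, hv, fun i u hu => by simpa only [norm_iteratedFDeriv_fderiv] using hb i u hu⟩
    refine ⟨?_, fun u => ?_⟩
    · push_cast
      rw [contDiff_succ_iff_fderiv, hd]
      exact ⟨fun u => (hasFDerivAt_tsum_of_hasLocalSummableBound hf
        (h 0) (h 1) u).differentiableAt, by simp, h₁⟩
    · simp only [← norm_iteratedFDeriv_fderiv, hd]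
      exact h₂ u

/-- A pointwise convergent series of Schwartz functions converges in the Schwartz space if all
seminorms are summable. -/
theorem hasSum_schwartz {f : ι → 𝓢(V, ℂ)} {Θ : 𝓢(V, ℂ)}
    (h : ∀ u, HasSum (fun i => f i u) (Θ u))
    (hs : ∀ k n : ℕ, Summable fun i => SchwartzMap.seminorm ℂ k n (f i)) : HasSum f Θ := by
  classical
  -- The remainder after a finite set `s` is again a series that may be differentiated termwise, so
  -- its seminorm is at most the tail of the series of seminorms.
  have hbound : ∀ (s : Finset ι) (m : ℕ),
      HasLocalSummableBound (fun (i : {x // x ∉ s}) => ⇑(f i)) m := fun s m _ =>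
    ⟨fun i => SchwartzMap.seminorm ℂ 0 m (f i), (hs 0 m).subtype _,
      fun i u _ => (f i).norm_iteratedFDeriv_le_seminorm ℂ m u⟩
  rw [HasSum, (schwartz_withSeminorms ℂ V ℂ).tendsto_nhds]
  rintro ⟨k, n⟩ ε hε
  have ht := tendsto_tsum_compl_atTop_zero fun i => SchwartzMap.seminorm ℂ k n (f i)
  filter_upwards [ht.eventually_lt_const hε] with s hsε
  refine lt_of_le_of_lt ?_ hsε
  rw [SchwartzMap.schwartzSeminormFamily_apply, ← neg_sub, map_neg_eq_map]
  refine SchwartzMap.seminorm_le_bound ℂ k n _ (tsum_nonneg fun i => apply_nonneg _ _)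
    fun u => ?_
  have he : ⇑(Θ - ∑ i ∈ s, f i) = fun u => ∑' i : {x // x ∉ s}, f i u := by
    funext u
    have := (h u).summable.sum_add_tsum_subtype_compl s
    rw [(h u).tsum_eq] at this
    simp [← this]
  rw [he]
  calc _ ≤ ‖u‖ ^ k * ∑' i : {x // x ∉ s}, ‖iteratedFDeriv ℝ n (f i) u‖ := by
        gcongr
        exact (contDiff_tsum_of_hasLocalSummableBound n
          (fun i : {x // x ∉ s} => (f i).smooth ⊤) (hbound s)).2 u
    _ = ∑' i : {x // x ∉ s}, ‖u‖ ^ k * ‖iteratedFDeriv ℝ n (f i) u‖ := tsum_mul_left.symm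
    _ ≤ _ := Summable.tsum_le_tsum (fun i => (f i).le_seminorm ℂ k n u)
        (((hbound s n).summable u).mul_left _) ((hs k n).subtype _)

end SmoothSeries

/-! ### Sums of polynomial weights over a lattice. -/

section LatticeSums

theorem one_add_norm_sub_le {V : Type} [NormedAddCommGroup V] (u v : V) : 1 + ‖u - v‖ ≤ (1 + ‖u‖) * (1 + ‖v‖) := by
  have := norm_sub_le u v
  have : 0 ≤ ‖u‖ * ‖v‖ := by positivity
  linarith

theorem one_add_norm_add_le {V : Type} [NormedAddCommGroup V] (u v : V) : 1 + ‖u + v‖ ≤ (1 + ‖u‖) * (1 + ‖v‖) := by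
  simpa using one_add_norm_sub_le u (-v)

variable {V : Type} [NormedAddCommGroup V] [NormedSpace ℝ V] [FiniteDimensional ℝ V]

theorem exists_near_lattice_point (Λ : Submodule ℤ V) [DiscreteTopology Λ] [IsZLattice ℝ Λ] :
    ∃ R : ℝ, 0 ≤ R ∧ ∀ u : V, ∃ l : Λ, ‖u - l‖ ≤ R := by
  let b := (Module.Free.chooseBasis ℤ Λ).ofZLatticeBasis ℝ Λ
  refine ⟨∑ i, ‖b i‖, by positivity, fun u => ⟨⟨ZSpan.floor b u, ?_⟩, ZSpan.norm_fract_le b u⟩⟩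
  exact ((Module.Free.chooseBasis ℤ Λ).ofZLatticeBasis_span ℝ).le (ZSpan.floor b u).2

theorem summable_lattice (Λ : Submodule ℤ V) [DiscreteTopology Λ] [IsZLattice ℝ Λ]
    {K : ℕ} (hK : Module.finrank ℝ V + 1 ≤ K) :
    Summable fun l : Λ => ((1 + ‖(l : V)‖) ^ K)⁻¹ := by
  have h := ZLattice.summable_norm_pow_inv Λ K (by rw [ZLattice.rank ℝ Λ]; omega)
  refine h.of_norm_bounded_eventually ?_
  refine ((Set.finite_singleton (0 : Λ)).subset fun l hl => ?_)
  by_contra hne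
  refine hl ?_
  have : 0 < ‖(l : V)‖ := norm_pos_iff.2 fun h => hne (Subtype.ext h)
  change ‖((1 + ‖(l : V)‖) ^ K)⁻¹‖ ≤ ‖(l : V)‖⁻¹ ^ K
  rw [Real.norm_of_nonneg (by positivity), inv_pow]
  exact inv_anti₀ (by positivity) (by gcongr; simp)

/-- Uniformity in `u` comes from periodicity: some lattice point `m` lies within `R` of `u`, and
replacing `u` by `m` costs a factor (1+R)^K. The sum centred at `m` is a reindexing of the one
centred at 0. -/
theorem exists_lattice_sum_bound (Λ : Submodule ℤ V) [DiscreteTopology Λ] [IsZLattice ℝ Λ]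
    {K : ℕ} (hK : Module.finrank ℝ V + 1 ≤ K) :
    ∃ C : ℝ, ∀ u : V, Summable (fun l : Λ => ((1 + ‖u - l‖) ^ K)⁻¹) ∧
      ∑' l : Λ, ((1 + ‖u - l‖) ^ K)⁻¹ ≤ C := by
  obtain ⟨R, hR, h⟩ := exists_near_lattice_point Λ
  have hs := summable_lattice Λ hK
  refine ⟨(1 + R) ^ K * ∑' l : Λ, ((1 + ‖(l : V)‖) ^ K)⁻¹, fun u => ?_⟩
  obtain ⟨m, hm⟩ := h u
  have hs' := ((Equiv.subRight m).summable_iff.2 hs).mul_left ((1 + R) ^ K)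
  have hle : ∀ l : Λ, ((1 + ‖u - l‖) ^ K)⁻¹ ≤
      (1 + R) ^ K * ((1 + ‖((Equiv.subRight m l : Λ) : V)‖) ^ K)⁻¹ := fun l => by
    rw [← div_eq_mul_inv, inv_le_iff_one_le_mul₀ (by positivity), div_mul_eq_mul_div,
      le_div_iff₀ (by positivity), one_mul, ← mul_pow]
    gcongr
    have := one_add_norm_sub_le (u - m) (u - l)
    simp only [sub_sub_sub_cancel_left] at this
    simp only [Equiv.subRight_apply, Submodule.coe_sub]
    refine this.trans ?_
    gcongr
  refine ⟨hs'.of_nonneg_of_le (fun _ => by positivity) hle, ?_⟩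
  refine (Summable.tsum_le_tsum hle (hs'.of_nonneg_of_le (fun _ => by positivity) hle) hs').trans_eq ?_
  rw [tsum_mul_left]
  congr 1
  exact (Equiv.subRight m).tsum_eq fun l : Λ => ((1 + ‖(l : V)‖) ^ K)⁻¹

end LatticeSums

/-! ### Derivatives of modulated translates of Schwartz functions. -/

section Modulation

variable {V : Type} [NormedAddCommGroup V] [NormedSpace ℝ V]

/-- The character `u ↦ e^{2πi ℓ(u)}`. -/
noncomputable def character (l : V →L[ℝ] ℝ) (u : V) : ℂ :=
  Complex.exp (2 * Real.pi * Complex.I * (l u : ℝ))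

theorem norm_character (l : V →L[ℝ] ℝ) (u : V) : ‖character l u‖ = 1 := by
  have : (2 * Real.pi * Complex.I * (l u : ℝ) : ℂ) = ((2 * Real.pi * l u : ℝ) : ℂ) * Complex.I := by
    push_cast; ring
  rw [character, this, Complex.norm_exp_ofReal_mul_I]

theorem contDiff_character (l : V →L[ℝ] ℝ) : ContDiff ℝ ∞ (character l) :=
  (contDiff_const.mul (Complex.ofRealCLM.contDiff.comp l.contDiff)).cexp

theorem norm_iteratedFDeriv_character_le (l : V →L[ℝ] ℝ) (n : ℕ) (u : V) :
    ‖iteratedFDeriv ℝ n (character l) u‖ ≤ (2 * Real.pi * ‖l‖) ^ n := by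
  have he : ContDiff ℝ ∞ (fun s : ℝ => Complex.exp (2 * Real.pi * Complex.I * s)) :=
    (contDiff_const.mul Complex.ofRealCLM.contDiff).cexp
  have hit : ∀ n : ℕ, iteratedDeriv n (fun s : ℝ => Complex.exp (2 * Real.pi * Complex.I * s))
      = fun s : ℝ => (2 * Real.pi * Complex.I) ^ n * Complex.exp (2 * Real.pi * Complex.I * s) := by
    intro n
    induction n with
    | zero => simp
    | succ n ih =>
      rw [iteratedDeriv_succ, ih]
      funext s
      have h1 : HasDerivAt (fun s : ℝ => 2 * Real.pi * Complex.I * (s : ℂ))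
          (2 * Real.pi * Complex.I) s := by
        simpa using (Complex.ofRealCLM.hasDerivAt (x := s)).const_mul (2 * Real.pi * Complex.I)
      rw [(h1.cexp.const_mul _).deriv]
      ring
  have h := l.iteratedFDeriv_comp_right he u (i := n) (mod_cast le_top)
  rw [show character l = (fun s : ℝ => Complex.exp (2 * Real.pi * Complex.I * s)) ∘ l from rfl, h]
  refine (ContinuousMultilinearMap.norm_compContinuousLinearMap_le _ _).trans ?_
  rw [norm_iteratedFDeriv_eq_norm_iteratedDeriv, hit, norm_mul]
  have h2 := norm_character l u
  rw [character] at h2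
  rw [h2]
  simp [abs_of_pos Real.pi_pos, mul_pow]

theorem exists_weighted_deriv_bound (Φ : 𝓢(V, ℂ)) (n N : ℕ) :
    ∃ C : ℝ, 0 ≤ C ∧ ∀ u, (1 + ‖u‖) ^ N * ‖iteratedFDeriv ℝ n Φ u‖ ≤ C := by
  refine ⟨2 ^ N * ((Finset.Iic (N, n)).sup fun p => SchwartzMap.seminorm ℝ p.1 p.2) Φ,
    by positivity, fun u => ?_⟩
  exact SchwartzMap.one_add_le_sup_seminorm_apply (𝕜 := ℝ) (m := (N, n)) le_rfl le_rfl Φ u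

/-- The derivatives of a product of a function with bounded derivatives and a translated Schwartz
function. -/
theorem exists_mul_translate_bound (Φ : 𝓢(V, ℂ)) (n N : ℕ) : ∃ C : ℝ, 0 ≤ C ∧
    ∀ (b : V → ℂ) (B : ℝ), ContDiff ℝ ∞ b → (∀ i ≤ n, ∀ u, ‖iteratedFDeriv ℝ i b u‖ ≤ B) →
      ∀ x u : V, (1 + ‖u - x‖) ^ N * ‖iteratedFDeriv ℝ n (fun u => b u * Φ (u - x)) u‖ ≤ C * B := by
  choose c hc hΦ using fun i => exists_weighted_deriv_bound Φ i N
  refine ⟨∑ i ∈ Finset.range (n + 1), n.choose i * c (n - i),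
    Finset.sum_nonneg fun i _ => mul_nonneg (by positivity) (hc _), fun b B hb hB x u => ?_⟩
  have h := norm_iteratedFDeriv_mul_le (𝕜 := ℝ) (N := ∞) hb
    ((Φ.smooth ⊤).comp (contDiff_id.sub contDiff_const : ContDiff ℝ ∞ fun u : V => u - x)) u
    (n := n) (mod_cast le_top)
  refine (mul_le_mul_of_nonneg_left h (by positivity)).trans ?_
  rw [Finset.mul_sum, Finset.sum_mul]
  refine Finset.sum_le_sum fun i hi => ?_
  have h1 := hΦ (n - i) (u - x)
  have h2 := hB i (by simpa [Nat.lt_succ_iff] using hi) u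
  have h3 : iteratedFDeriv ℝ (n - i) (Φ ∘ fun u => id u - x) u = iteratedFDeriv ℝ (n - i) Φ (u - x) :=
    iteratedFDeriv_comp_sub _ _ _
  rw [h3]
  calc _ = n.choose i * ((1 + ‖u - x‖) ^ N * ‖iteratedFDeriv ℝ (n - i) Φ (u - x)‖)
        * ‖iteratedFDeriv ℝ i b u‖ := by ring
    _ ≤ _ := by
      gcongr
      exact mul_nonneg (by positivity) (hc _)

/-- By the Leibniz rule at most `n` derivatives fall on the character, each costing 2π‖l‖. The
constant depends neither on the frequency `l` nor on the centre `x`. -/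
theorem exists_atom_deriv_bound (Φ : 𝓢(V, ℂ)) (n N : ℕ) : ∃ C : ℝ, 0 ≤ C ∧
    ∀ (l : V →L[ℝ] ℝ) (x u : V),
      (1 + ‖u - x‖) ^ N * ‖iteratedFDeriv ℝ n (fun u => character l u * Φ (u - x)) u‖
        ≤ C * (1 + ‖l‖) ^ n := by
  obtain ⟨C, hC, h⟩ := exists_mul_translate_bound Φ n N
  refine ⟨C * (2 * Real.pi) ^ n, by positivity, fun l x u => ?_⟩
  rw [mul_assoc, ← mul_pow]
  refine h (character l) _ (contDiff_character l) (fun i hi u => ?_) x u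
  have hpi : (1 : ℝ) ≤ 2 * Real.pi := by linarith [Real.pi_gt_three]
  refine (norm_iteratedFDeriv_character_le l i u).trans ?_
  calc (2 * Real.pi * ‖l‖) ^ i ≤ (2 * Real.pi * (1 + ‖l‖)) ^ i := by gcongr; simp
    _ ≤ _ := pow_le_pow_right₀ (one_le_mul_of_one_le_of_one_le hpi (by simp)) hi

end Modulation

/-! ### The symplectic form and decay of oscillatory integrals. -/

section Oscillatory

variable {E : Type} [NormedAddCommGroup E] [InnerProductSpace ℝ E] [FiniteDimensional ℝ E]
  [MeasurableSpace E] [BorelSpace E]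

/-- The symplectic form on phase space. -/
noncomputable def symp : (E × E) →L[ℝ] (E × E) →L[ℝ] ℝ :=
  (innerSL ℝ).bilinearComp (ContinuousLinearMap.fst ℝ E E) (ContinuousLinearMap.snd ℝ E E)
    - (innerSL ℝ).bilinearComp (ContinuousLinearMap.snd ℝ E E) (ContinuousLinearMap.fst ℝ E E)

theorem symp_apply (u ζ : E × E) : symp u ζ = inner ℝ u.1 ζ.2 - inner ℝ u.2 ζ.1 := rfl

/-- The right side is the Euclidean square norm, while ‖ζ‖ is the maximum norm of the product. This
direction serves to integrate by parts in `exists_oscillatory_decay`. -/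
theorem sq_norm_le_symp (ζ : E × E) : ‖ζ‖ ^ 2 ≤ symp (ζ.2, -ζ.1) ζ := by
  rw [symp_apply]
  simp only [inner_neg_left, real_inner_self_eq_norm_sq]
  rcases max_choice ‖ζ.1‖ ‖ζ.2‖ with h | h <;> rw [Prod.norm_def, h] <;> nlinarith [sq_nonneg ‖ζ.1‖, sq_nonneg ‖ζ.2‖]

instance : (volume : Measure (E × E)).IsAddHaarMeasure := by
  rw [Measure.volume_eq_prod]; infer_instance

theorem integrable_weight_inv :
    Integrable fun u : E × E =>
      ((1 + ‖u‖) ^ (volume : Measure (E × E)).integrablePower)⁻¹ := by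
  have := Measure.integrable_pow_neg_integrablePower (volume : Measure (E × E))
  simpa [Real.rpow_neg, Real.rpow_natCast, add_nonneg] using this

/-- Decay of oscillatory integrals against functions with bounded derivatives. -/
theorem exists_oscillatory_decay (Φ : 𝓢(E × E, ℂ)) {b : E × E → ℂ} (hb : IsHormanderFun b) (n : ℕ) :
    ∃ C : ℝ, ∀ x ζ : E × E, (1 + ‖ζ‖) ^ n *
      ‖∫ u, character (-symp.flip ζ) u * (b u * Φ (u - x))‖ ≤ C := by
  set K := (volume : Measure (E × E)).integrablePower
  choose D hD using hb.2
  choose c hc hΦ using fun m => exists_mul_translate_bound Φ m K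
  set I := ∫ u : E × E, ((1 + ‖u‖) ^ K)⁻¹ with hI
  have hI0 : 0 ≤ I := integral_nonneg fun u => by positivity
  set B : ℕ → ℝ := fun m => ∑ i ∈ Finset.range (m + 1), |D i|
  have hB0 : ∀ m, 0 ≤ B m := fun m => Finset.sum_nonneg fun _ _ => abs_nonneg _
  have hpt : ∀ m (x u : E × E), ‖iteratedFDeriv ℝ m (fun u => b u * Φ (u - x)) u‖
      ≤ c m * B m * ((1 + ‖u - x‖) ^ K)⁻¹ := fun m x u => by
    rw [← div_eq_mul_inv, le_div_iff₀' (by positivity)]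
    refine hΦ m b (B m) hb.1 (fun i hi u => (hD i u).trans ((le_abs_self _).trans ?_)) x u
    exact Finset.single_le_sum (f := fun i => |D i|) (fun _ _ => abs_nonneg _)
      (by simpa [Nat.lt_succ_iff] using hi)
  have hsm : ∀ x : E × E, ContDiff ℝ ∞ fun u => b u * Φ (u - x) := fun x =>
    hb.1.mul ((Φ.smooth ⊤).comp (contDiff_id.sub contDiff_const))
  have hint : ∀ m (x : E × E),
      Integrable fun u => ‖iteratedFDeriv ℝ m (fun u => b u * Φ (u - x)) u‖ := fun m x => by
    refine ((integrable_weight_inv.comp_sub_right x).const_mul (c m * B m)).mono'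
      ((hsm x).continuous_iteratedFDeriv (by exact_mod_cast le_top)).norm.aestronglyMeasurable
      (Filter.Eventually.of_forall fun u => ?_)
    rw [norm_norm]
    exact hpt m x u
  have hle : ∀ m (x : E × E), ∫ u, ‖iteratedFDeriv ℝ m (fun u => b u * Φ (u - x)) u‖
      ≤ c m * B m * I := fun m x => by
    refine (integral_mono (hint m x) ((integrable_weight_inv.comp_sub_right x).const_mul _)
      (hpt m x)).trans_eq ?_
    rw [integral_const_mul, integral_sub_right_eq_self (μ := volume)
      (fun u : E × E => ((1 + ‖u‖) ^ K)⁻¹) x]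
  have key : ∀ m (x ζ : E × E), ‖ζ‖ ^ m *
      ‖∫ u, character (-symp.flip ζ) u * (b u * Φ (u - x))‖
        ≤ 2 ^ m * ∑ i ∈ Finset.range (m + 1), c i * B i * I := fun m x ζ => by
    -- Integration by parts `m` times in the direction v = (ζ.2, -ζ.1). Since ‖v‖ = ‖ζ‖ and |symp v
    -- ζ| ≥ ‖ζ‖², one factor ‖ζ‖^m cancels and one remains.
    have h := VectorFourier.pow_mul_norm_iteratedFDeriv_fourierIntegral_le symp
      (K := 0) (N := m) (k := 0) (n := m) (μ := volume)
      ((hsm x).of_le (by exact_mod_cast le_top))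
      (fun k n hk _ => by
        obtain rfl : k = 0 := by simpa using hk
        simpa using hint n x) le_rfl le_rfl (ζ.2, -ζ.1) ζ
    have hv : ‖((ζ.2, -ζ.1) : E × E)‖ = ‖ζ‖ := by
      simp [Prod.norm_def, max_comm]
    have hF : VectorFourier.fourierIntegral 𝐞 volume (symp (E := E)).toLinearMap₁₂
        (fun u => b u * Φ (u - x)) ζ
        = ∫ u, character (-symp.flip ζ) u * (b u * Φ (u - x)) := by
      unfold VectorFourier.fourierIntegral
      congr 1
      funext u
      rw [Circle.smul_def, Real.fourierChar_apply, smul_eq_mul, character]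
      congr 2
      simp
      ring
    simp only [norm_iteratedFDeriv_zero, hF, hv, pow_zero, mul_one, Nat.cast_zero, mul_zero,
      zero_add, Finset.range_one] at h
    rw [Finset.sum_product] at h
    simp only [Finset.sum_singleton, pow_zero, one_mul] at h
    have hS : ∑ i ∈ Finset.range (m + 1),
        ∫ u, ‖iteratedFDeriv ℝ i (fun u => b u * Φ (u - x)) u‖
          ≤ ∑ i ∈ Finset.range (m + 1), c i * B i * I := Finset.sum_le_sum fun i _ => hle i x
    have hS0 : 0 ≤ ∑ i ∈ Finset.range (m + 1), c i * B i * I :=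
      Finset.sum_nonneg fun i _ => mul_nonneg (mul_nonneg (hc i) (hB0 i)) hI0
    rcases (pow_nonneg (norm_nonneg ζ) m).eq_or_lt with h0 | hpos
    · rw [← h0, zero_mul]
      positivity
    refine le_of_mul_le_mul_left (le_trans ?_ (h.trans ?_)) hpos
    · rw [← mul_assoc, ← mul_pow, ← sq]
      gcongr
      exact (sq_norm_le_symp ζ).trans (le_abs_self _)
    · rw [mul_assoc]
      gcongr
  -- The case m = 0 covers small ζ and m = n large ζ, through (1+‖ζ‖)^n ≤ 2^n (1+‖ζ‖^n).
  refine ⟨2 ^ n * (2 ^ 0 * ∑ i ∈ Finset.range (0 + 1), c i * B i * I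
    + 2 ^ n * ∑ i ∈ Finset.range (n + 1), c i * B i * I), fun x ζ => ?_⟩
  have h0 := key 0 x ζ
  have hn := key n x ζ
  set F := ‖∫ u, character (-symp.flip ζ) u * (b u * Φ (u - x))‖
  have hF : 0 ≤ F := norm_nonneg _
  have hpow : (1 + ‖ζ‖) ^ n ≤ 2 ^ n * (‖ζ‖ ^ 0 + ‖ζ‖ ^ n) := by
    rw [pow_zero]
    rcases le_total ‖ζ‖ 1 with h | h
    · calc (1 + ‖ζ‖) ^ n ≤ 2 ^ n := by gcongr; linarith
        _ ≤ _ := le_mul_of_one_le_right (by positivity) (by simp)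
    · calc (1 + ‖ζ‖) ^ n ≤ (2 * ‖ζ‖) ^ n := by gcongr; linarith
        _ ≤ _ := by rw [mul_pow]; gcongr; simp
  calc _ ≤ 2 ^ n * (‖ζ‖ ^ 0 + ‖ζ‖ ^ n) * F := by gcongr
    _ = 2 ^ n * (‖ζ‖ ^ 0 * F + ‖ζ‖ ^ n * F) := by ring
    _ ≤ _ := by gcongr

end Oscillatory

/-! ### Covariance of the Wigner distribution and the atoms. -/

variable {E : Type} [NormedAddCommGroup E] [InnerProductSpace ℝ E] [FiniteDimensional ℝ E]
  [MeasurableSpace E] [BorelSpace E]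

/-- The unimodular factor in the covariance property of the Wigner distribution. -/
noncomputable def wignerPhase (w z : E × E) : ℂ :=
  Complex.exp (2 * Real.pi * Complex.I * ((inner ℝ (w.2 + z.2) (w.1 - z.1) / 2 : ℝ) : ℂ))

theorem norm_wignerPhase (w z : E × E) : ‖wignerPhase w z‖ = 1 := by
  have : (2 * Real.pi * Complex.I * ((inner ℝ (w.2 + z.2) (w.1 - z.1) / 2 : ℝ) : ℂ)) =
      ((2 * Real.pi * (inner ℝ (w.2 + z.2) (w.1 - z.1) / 2) : ℝ) : ℂ) * Complex.I := by
    push_cast; ring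
  rw [wignerPhase, this, Complex.norm_exp_ofReal_mul_I]

/-- Covariance of the Wigner distribution under time-frequency shifts. -/
theorem wigner_timeFreqShift (f h : 𝓢(E, ℂ)) (w z u : E × E) :
    wigner (timeFreqShift w f) (timeFreqShift z h) u = wignerPhase w z *
      (character (symp.flip (w - z)) u * wigner f h (u - (1 / 2 : ℝ) • (w + z))) := by
  -- The substitution t ↦ t + (w.1 - z.1) makes both translated arguments symmetric about the
  -- shifted point u - (w+z)/2.
  rw [wigner_apply, wigner_apply, wignerFun, wignerFun,
    ← integral_add_right_eq_self (μ := volume) _ (w.1 - z.1), ← mul_assoc, ← integral_const_mul]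
  congr 1
  funext t
  have e1 : u.1 + (1 / 2 : ℝ) • (t + (w.1 - z.1)) - w.1
      = (u - (1 / 2 : ℝ) • (w + z)).1 + (1 / 2 : ℝ) • t := by simp; module
  have e2 : u.1 - (1 / 2 : ℝ) • (t + (w.1 - z.1)) - z.1
      = (u - (1 / 2 : ℝ) • (w + z)).1 - (1 / 2 : ℝ) • t := by simp; module
  rw [timeFreqShift_apply, timeFreqShift_apply, e1, e2, map_mul, ← Complex.exp_conj]
  have key : Complex.exp (2 * Real.pi * Complex.I *
        (inner ℝ w.2 (u.1 + (1 / 2 : ℝ) • (t + (w.1 - z.1))) : ℝ))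
      * Complex.exp ((starRingEnd ℂ) (2 * Real.pi * Complex.I *
        (inner ℝ z.2 (u.1 - (1 / 2 : ℝ) • (t + (w.1 - z.1))) : ℝ)))
      * Complex.exp (-(2 * Real.pi * Complex.I * (inner ℝ (t + (w.1 - z.1)) u.2 : ℝ)))
      = wignerPhase w z * character (symp.flip (w - z)) u *
        Complex.exp (-(2 * Real.pi * Complex.I *
          (inner ℝ t (u - (1 / 2 : ℝ) • (w + z)).2 : ℝ))) := by
    rw [wignerPhase, character, ← Complex.exp_add, ← Complex.exp_add, ← Complex.exp_add,
      ← Complex.exp_add]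
    congr 1
    simp only [map_mul, Complex.conj_ofReal, Complex.conj_I, map_ofNat,
      ContinuousLinearMap.flip_apply, symp_apply, inner_add_left, inner_add_right, inner_sub_left,
      inner_sub_right, real_inner_smul_right, Prod.fst_sub, Prod.snd_sub, Prod.snd_add,
      Prod.smul_snd]
    rw [real_inner_comm u.1 w.2, real_inner_comm u.1 z.2, real_inner_comm u.2 w.1,
      real_inner_comm u.2 z.1, real_inner_comm w.2 t, real_inner_comm z.2 t]
    push_cast
    ring
  linear_combination (f ((u - (1 / 2 : ℝ) • (w + z)).1 + (1 / 2 : ℝ) • t)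
    * starRingEnd ℂ (h ((u - (1 / 2 : ℝ) • (w + z)).1 - (1 / 2 : ℝ) • t))) * key

/-- The Wigner distribution `W(π(w) g, π(z) g)`. -/
noncomputable def atom (g : 𝓢(E, ℂ)) (w z : E × E) : 𝓢(E × E, ℂ) :=
  wigner (timeFreqShift w g) (timeFreqShift z g)

theorem weylForm_timeFreqShift (σ : 𝓢'(E × E, ℂ)) (g : 𝓢(E, ℂ)) (z w : E × E) :
    weylForm σ (timeFreqShift z g) (timeFreqShift w g) = σ (conj (atom g w z)) := rfl

theorem exists_atom_bound (g : 𝓢(E, ℂ)) (n N : ℕ) : ∃ C : ℝ, 0 ≤ C ∧ ∀ w z u : E × E,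
    (1 + ‖u - (1 / 2 : ℝ) • (w + z)‖) ^ N * ‖iteratedFDeriv ℝ n (atom g w z) u‖
      ≤ C * (1 + ‖w - z‖) ^ n := by
  obtain ⟨C, hC, h⟩ := exists_atom_deriv_bound (wigner g g) n N
  set L := ‖(symp (E := E)).flip‖
  refine ⟨C * (1 + L) ^ n, by positivity, fun w z u => ?_⟩
  have he : ⇑(atom g w z) = wignerPhase w z • fun u => character (symp.flip (w - z)) u *
      wigner g g (u - (1 / 2 : ℝ) • (w + z)) := funext fun u => wigner_timeFreqShift g g w z u
  have hs : ContDiff ℝ ∞ fun u => character (symp.flip (w - z)) u *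
      wigner g g (u - (1 / 2 : ℝ) • (w + z)) := (contDiff_character _).mul
    (((wigner g g).smooth ⊤).comp (contDiff_id.sub contDiff_const))
  rw [he, iteratedFDeriv_const_smul_apply (hs.contDiffAt.of_le (by exact_mod_cast le_top)),
    norm_smul, norm_wignerPhase, one_mul]
  refine (h _ _ _).trans ?_
  rw [mul_assoc, ← mul_pow]
  gcongr
  have := (symp (E := E)).flip.le_opNorm (w - z)
  have h0 : 0 ≤ ‖w - z‖ := norm_nonneg _
  have h1 : 0 ≤ L := norm_nonneg (symp (E := E)).flip
  nlinarith

theorem conj_atom_apply (g : 𝓢(E, ℂ)) (w z u : E × E) :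
    starRingEnd ℂ (atom g w z u) = starRingEnd ℂ (wignerPhase w z) *
      (character (-symp.flip (w - z)) u *
        conj (wigner g g) (u - (1 / 2 : ℝ) • (w + z))) := by
  rw [atom, wigner_timeFreqShift, map_mul, map_mul, conj_apply]
  congr 2
  rw [character, character, ← Complex.exp_conj]
  congr 1
  simp only [map_mul, Complex.conj_ofReal, Complex.conj_I, Complex.conj_ofNat, neg_apply,
    Complex.ofReal_neg]
  ring

theorem exists_integral_mul_conj_atom_bound (g : 𝓢(E, ℂ)) {b : E × E → ℂ}
    (hb : IsHormanderFun b) (n : ℕ) : ∃ C : ℝ, ∀ w z : E × E,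
      (1 + ‖w - z‖) ^ n * ‖∫ u, starRingEnd ℂ (atom g w z u) * b u‖ ≤ C := by
  obtain ⟨C, h⟩ := exists_oscillatory_decay (conj (wigner g g)) hb n
  refine ⟨C, fun w z => ?_⟩
  refine le_of_eq_of_le ?_ (h ((1 / 2 : ℝ) • (w + z)) (w - z))
  congr 1
  have : ∀ u, starRingEnd ℂ (atom g w z u) * b u = starRingEnd ℂ (wignerPhase w z) *
      (character (-symp.flip (w - z)) u *
        (b u * conj (wigner g g) (u - (1 / 2 : ℝ) • (w + z)))) := fun u => by
    rw [conj_atom_apply]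
    ring
  simp_rw [this]
  rw [integral_const_mul, norm_mul, RCLike.norm_conj, norm_wignerPhase, one_mul]

/-! ### Gabor matrices of Hörmander symbols. -/

theorem bracket_le (z : E × E) : bracket z ≤ 2 * (1 + ‖z‖) := by
  refine Real.sqrt_le_iff.2 ⟨by positivity, ?_⟩
  have h1 := norm_fst_le z
  have h2 := norm_snd_le z
  nlinarith [norm_nonneg z.1, norm_nonneg z.2]

theorem one_add_norm_le_bracket (z : E × E) : 1 + ‖z‖ ≤ 2 * bracket z := by
  have : 1 + ‖z‖ ^ 2 ≤ 1 + (‖z.1‖ ^ 2 + ‖z.2‖ ^ 2) := by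
    rcases max_choice ‖z.1‖ ‖z.2‖ with h | h <;> rw [Prod.norm_def, h] <;>
      nlinarith [sq_nonneg ‖z.1‖, sq_nonneg ‖z.2‖]
  have h2 : 1 + ‖z‖ ≤ Real.sqrt (4 * (1 + (‖z.1‖ ^ 2 + ‖z.2‖ ^ 2))) :=
    Real.le_sqrt_of_sq_le (by nlinarith [sq_nonneg (1 - ‖z‖)])
  refine h2.trans_eq ?_
  rw [Real.sqrt_mul (by norm_num), bracket, show (4 : ℝ) = 2 ^ 2 by norm_num,
    Real.sqrt_sq (by norm_num)]

theorem one_le_bracket (z : E × E) : 1 ≤ bracket z :=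
  Real.one_le_sqrt.2 (by linarith [sq_nonneg ‖z.1‖, sq_nonneg ‖z.2‖])

theorem toTemperedDistribution_apply {a : E × E → ℂ} (ha : IsHormanderFun a) (Ψ : 𝓢(E × E, ℂ)) :
    (Function.HasTemperateGrowth.toTemperedDistribution volume ha.hasTemperateGrowth :
      𝓢'(E × E, ℂ)) Ψ = ∫ u, Ψ u * a u :=
  Function.HasTemperateGrowth.toTemperedDistribution_apply volume ha.hasTemperateGrowth Ψ

/-- The Gabor matrix of an operator with symbol in the Hörmander class. -/
theorem IsHormanderSymbol.exists_weylForm_bound {σ : 𝓢'(E × E, ℂ)} (h : IsHormanderSymbol σ)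
    (g : 𝓢(E, ℂ)) (s : ℝ) : ∃ C : ℝ, ∀ z w : E × E,
      ‖weylForm σ (timeFreqShift z g) (timeFreqShift w g)‖ ≤ C * bracket (w - z) ^ (-s) := by
  obtain ⟨a, ha, rfl⟩ := h
  obtain ⟨n, hn⟩ := exists_nat_ge s
  obtain ⟨C, hC⟩ := exists_integral_mul_conj_atom_bound g ha n
  refine ⟨2 ^ n * C, fun z w => ?_⟩
  rw [weylForm_timeFreqShift, toTemperedDistribution_apply ha]
  have h1 := hC w z
  simp only [conj_apply]
  set F := ‖∫ u, starRingEnd ℂ (atom g w z u) * a u‖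
  have hb := one_le_bracket (w - z)
  rw [Real.rpow_neg (by linarith), ← div_eq_mul_inv, le_div_iff₀ (by positivity)]
  calc F * bracket (w - z) ^ s ≤ F * bracket (w - z) ^ n := by
        rw [← Real.rpow_natCast]
        gcongr
    _ ≤ F * (2 * (1 + ‖w - z‖)) ^ n := by
        gcongr
        exact bracket_le _
    _ = 2 ^ n * ((1 + ‖w - z‖) ^ n * F) := by rw [mul_pow]; ring
    _ ≤ _ := by gcongr

/-! ### Decay of the atomic coefficients of Schwartz functions. -/

theorem exists_integral_norm_atom_mul_bound (g : 𝓢(E, ℂ)) (Ψ : 𝓢(E × E, ℂ)) (N : ℕ) :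
    ∃ C : ℝ, ∀ w z : E × E,
      (1 + ‖(1 / 2 : ℝ) • (w + z)‖) ^ N * ∫ u, ‖atom g w z u‖ * ‖Ψ u‖ ≤ C := by
  obtain ⟨A, hA, hatom⟩ := exists_atom_bound g 0 N
  set K := (volume : Measure (E × E)).integrablePower
  -- Of the decay of Ψ, the power `N` moves the weight from `u` to the midpoint and the power `K`
  -- makes the integral converge.
  obtain ⟨B, hB, hΨ⟩ := exists_weighted_deriv_bound Ψ 0 (N + K)
  simp only [norm_iteratedFDeriv_zero, pow_zero, mul_one] at hatom hΨ
  refine ⟨A * B * ∫ u : E × E, ((1 + ‖u‖) ^ K)⁻¹, fun w z => ?_⟩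
  rw [← integral_const_mul, ← integral_const_mul]
  have hle : ∀ u, (1 + ‖(1 / 2 : ℝ) • (w + z)‖) ^ N * (‖atom g w z u‖ * ‖Ψ u‖)
      ≤ A * B * ((1 + ‖u‖) ^ K)⁻¹ := fun u => by
    rw [← div_eq_mul_inv, le_div_iff₀ (by positivity)]
    have h1 : (1 + ‖(1 / 2 : ℝ) • (w + z)‖) ^ N
        ≤ ((1 + ‖u‖) * (1 + ‖u - (1 / 2 : ℝ) • (w + z)‖)) ^ N := by
      gcongr
      simpa using one_add_norm_sub_le u (u - (1 / 2 : ℝ) • (w + z))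
    calc _ ≤ ((1 + ‖u‖) * (1 + ‖u - (1 / 2 : ℝ) • (w + z)‖)) ^ N
          * (‖atom g w z u‖ * ‖Ψ u‖) * (1 + ‖u‖) ^ K := by gcongr
      _ = ((1 + ‖u - (1 / 2 : ℝ) • (w + z)‖) ^ N * ‖atom g w z u‖)
          * ((1 + ‖u‖) ^ (N + K) * ‖Ψ u‖) := by rw [mul_pow, pow_add]; ring
      _ ≤ _ := mul_le_mul (hatom w z u) (hΨ u) (by positivity) hA
  refine integral_mono_of_nonneg (Filter.Eventually.of_forall fun u => by positivity)
    (integrable_weight_inv.const_mul _) (Filter.Eventually.of_forall hle)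

theorem isHormanderFun_schwartz (Ψ : 𝓢(E × E, ℂ)) : IsHormanderFun Ψ :=
  ⟨Ψ.smooth ⊤, fun n => ⟨_, Ψ.norm_iteratedFDeriv_le_seminorm ℝ n⟩⟩

/-- The points w and z are the midpoint plus and minus half the difference. So decay about the
midpoint, combined with decay in w - z, becomes separate decay about w and about z, which can be
summed over Λ × Λ. -/
theorem weight_mul_weight_le {V : Type} [NormedAddCommGroup V] [NormedSpace ℝ V] (u w z : V) : (1 + ‖u - w‖) * (1 + ‖u - z‖)
    ≤ ((1 + ‖u - (1 / 2 : ℝ) • (w + z)‖) * (1 + ‖w - z‖)) ^ 2 := by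
  have h : 1 + ‖(1 / 2 : ℝ) • (w - z)‖ ≤ 1 + ‖w - z‖ := by
    rw [norm_smul]
    norm_num
    linarith [norm_nonneg (w - z)]
  have h1 := one_add_norm_sub_le (u - (1 / 2 : ℝ) • (w + z)) ((1 / 2 : ℝ) • (w - z))
  have h2 := one_add_norm_add_le (u - (1 / 2 : ℝ) • (w + z)) ((1 / 2 : ℝ) • (w - z))
  have e1 : u - (1 / 2 : ℝ) • (w + z) - (1 / 2 : ℝ) • (w - z) = u - w := by module
  have e2 : u - (1 / 2 : ℝ) • (w + z) + (1 / 2 : ℝ) • (w - z) = u - z := by module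
  rw [e1] at h1
  rw [e2] at h2
  rw [sq]
  gcongr
  · exact h1.trans (by gcongr)
  · exact h2.trans (by gcongr)

/-- The coefficients of a Schwartz function with respect to the atoms are rapidly decreasing. -/
theorem exists_coeff_bound (g : 𝓢(E, ℂ)) (Ψ : 𝓢(E × E, ℂ)) (N : ℕ) : ∃ C : ℝ, 0 ≤ C ∧
    ∀ w z : E × E, ‖∫ u, starRingEnd ℂ (atom g w z u) * Ψ u‖
      ≤ C * (((1 + ‖w‖) ^ N)⁻¹ * ((1 + ‖z‖) ^ N)⁻¹) := by
  -- Oscillation gives decay in w - z and localisation gives decay in the midpoint, but each bounds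
  -- the integral separately. The exponent 4N arises from (XY)^(2N) ≤ X^(4N) + Y^(4N).
  obtain ⟨A, hA⟩ := exists_integral_mul_conj_atom_bound g (isHormanderFun_schwartz Ψ) (4 * N)
  obtain ⟨B, hB⟩ := exists_integral_norm_atom_mul_bound g Ψ (4 * N)
  have hA0 : 0 ≤ A := le_trans (by positivity) (hA 0 0)
  have hB0 : 0 ≤ B := le_trans
    (mul_nonneg (by positivity) (integral_nonneg fun _ => by positivity)) (hB 0 0)
  refine ⟨A + B, by positivity, fun w z => ?_⟩
  rw [← mul_inv, ← div_eq_mul_inv, le_div_iff₀ (by positivity), ← mul_pow]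
  have h1 := hA w z
  have h2 := hB w z
  set F := ‖∫ u, starRingEnd ℂ (atom g w z u) * Ψ u‖ with hF
  have h3 : F ≤ ∫ u, ‖atom g w z u‖ * ‖Ψ u‖ := by
    refine (norm_integral_le_integral_norm _).trans_eq ?_
    simp
  have hw := weight_mul_weight_le 0 w z
  simp only [zero_sub, norm_neg] at hw
  set X := 1 + ‖(1 / 2 : ℝ) • (w + z)‖ with hX
  set Y := 1 + ‖w - z‖ with hY
  have hX0 : 0 ≤ X := by positivity
  have hY0 : 0 ≤ Y := by positivity
  have hF0 : 0 ≤ F := norm_nonneg _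
  have h4 : X ^ (4 * N) * F ≤ B := (by gcongr : X ^ (4 * N) * F ≤ _).trans h2
  calc F * ((1 + ‖w‖) * (1 + ‖z‖)) ^ N ≤ F * ((X * Y) ^ 2) ^ N := by gcongr
    _ ≤ F * (X ^ (4 * N) + Y ^ (4 * N)) := by
      gcongr
      have e1 : ((X * Y) ^ 2) ^ N = X ^ (2 * N) * Y ^ (2 * N) := by rw [← pow_mul, mul_pow]
      have e2 : X ^ (4 * N) = X ^ (2 * N) * X ^ (2 * N) := by rw [← pow_add]; congr 1; ring
      have e3 : Y ^ (4 * N) = Y ^ (2 * N) * Y ^ (2 * N) := by rw [← pow_add]; congr 1; ring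
      rw [e1, e2, e3]
      nlinarith [sq_nonneg (X ^ (2 * N) - Y ^ (2 * N)), sq_nonneg (X ^ (2 * N) + Y ^ (2 * N))]
    _ ≤ _ := by linarith

/-! ### The Wigner map as a bijection of Schwartz functions preserving the inner product. -/

theorem hasTemperateGrowth_prodMk (x : E) :
    (fun t : E => (x, t)).HasTemperateGrowth := by
  have h := (Function.HasTemperateGrowth.const ((x, 0) : E × E)).add
    (ContinuousLinearMap.inr ℝ E E).hasTemperateGrowth
  convert h using 1
  funext t
  simp

/-- The section `t ↦ F (x, t)` of a Schwartz function. -/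
noncomputable def sectionMap (F : 𝓢(E × E, ℂ)) (x : E) : 𝓢(E, ℂ) :=
  SchwartzMap.compCLMOfAntilipschitz ℂ (K := 1) (g := fun t : E => (x, t))
    (hasTemperateGrowth_prodMk x)
    (AntilipschitzWith.of_le_mul_dist fun s t => by simp [Prod.dist_eq]) F

theorem sectionMap_apply (F : 𝓢(E × E, ℂ)) (x t : E) : sectionMap F x t = F (x, t) := rfl

/-- The partial Fourier transform as a map of Schwartz functions. -/
noncomputable def partialFourierSchwartz (F : 𝓢(E × E, ℂ)) : 𝓢(E × E, ℂ) where
  toFun := partialFourier F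
  smooth' := contDiff_infty.2 fun n => contDiff_partialFourier n F
  decay' k n := decay_partialFourier k n F

theorem partialFourierSchwartz_apply (F : 𝓢(E × E, ℂ)) (x ξ : E) :
    partialFourierSchwartz F (x, ξ) = 𝓕 (sectionMap F x) ξ := rfl

/-- A preimage is the partial inverse Fourier transform, realised as the partial Fourier transform
followed by a reflection of the second variable. -/
theorem partialFourierSchwartz_surjective :
    Function.Surjective (partialFourierSchwartz (E := E)) := fun Ψ => by
  let e : (E × E) ≃L[ℝ] (E × E) :=
    (ContinuousLinearEquiv.refl ℝ E).prodCongr (ContinuousLinearEquiv.neg ℝ)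
  refine ⟨SchwartzMap.compCLMOfContinuousLinearEquiv ℂ e (partialFourierSchwartz Ψ), ?_⟩
  ext ⟨x, ξ⟩
  rw [partialFourierSchwartz_apply]
  have : sectionMap (SchwartzMap.compCLMOfContinuousLinearEquiv ℂ e (partialFourierSchwartz Ψ)) x
      = 𝓕⁻ (sectionMap Ψ x) := by
    ext t
    rw [SchwartzMap.fourierInv_coe, Real.fourierInv_eq_fourier_neg, ← SchwartzMap.fourier_coe,
      ← partialFourierSchwartz_apply]
    rfl
  rw [this, FourierTransform.fourier_fourierInv_eq, sectionMap_apply]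

theorem integrable_conj_mul {D : Type} [NormedAddCommGroup D] [NormedSpace ℝ D]
    [FiniteDimensional ℝ D] [MeasurableSpace D] [BorelSpace D] {μ : Measure D}
    [μ.HasTemperateGrowth] (F G : 𝓢(D, ℂ)) :
    Integrable (fun z => starRingEnd ℂ (F z) * G z) μ := by
  refine (G.integrable (μ := μ)).bdd_mul (c := SchwartzMap.seminorm ℝ 0 0 F)
    (Complex.continuous_conj.comp F.continuous).aestronglyMeasurable
    (Filter.Eventually.of_forall fun z => ?_)
  rw [RCLike.norm_conj]
  exact F.norm_le_seminorm ℝ z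

/-- Parseval on each section in the second variable, then Fubini. -/
theorem integral_conj_partialFourier_mul (F G : 𝓢(E × E, ℂ)) :
    ∫ z, starRingEnd ℂ (partialFourierSchwartz F z) * partialFourierSchwartz G z
      = ∫ z, starRingEnd ℂ (F z) * G z := by
  have h1 := integrable_conj_mul (μ := (volume : Measure (E × E))) (partialFourierSchwartz F)
    (partialFourierSchwartz G)
  have h2 := integrable_conj_mul (μ := (volume : Measure (E × E))) F G
  rw [Measure.volume_eq_prod] at h1 h2 ⊢
  rw [integral_prod _ h1, integral_prod _ h2]
  congr 1
  funext x
  have := SchwartzMap.integral_inner_fourier_fourier (sectionMap F x) (sectionMap G x)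
  simp only [RCLike.inner_apply] at this
  simpa only [partialFourierSchwartz_apply, sectionMap_apply, mul_comm] using this

/-- The map factors into two shears and three coordinate swaps, each of which preserves the product
measure. -/
theorem measurePreserving_wignerEquiv :
    MeasurePreserving (wignerEquiv : (E × E) → (E × E)) volume volume := by
  have h1 : MeasurePreserving (fun z : E × E => (z.1, z.2 - (1 / 2 : ℝ) • z.1))
      (volume.prod volume) (volume.prod volume) :=
    (MeasurePreserving.id volume).skew_product (g := fun s t : E => t - (1 / 2 : ℝ) • s)
      (Continuous.measurable (by fun_prop))
      (Filter.Eventually.of_forall fun s => (measurePreserving_sub_right volume _).map_eq)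
  have h2 : MeasurePreserving (fun z : E × E => (z.1, z.2 + z.1))
      (volume.prod volume) (volume.prod volume) :=
    (MeasurePreserving.id volume).skew_product (g := fun s t : E => t + s)
      (Continuous.measurable (by fun_prop))
      (Filter.Eventually.of_forall fun s => (measurePreserving_add_right volume s).map_eq)
  have hs : MeasurePreserving (Prod.swap : E × E → E × E)
      (volume.prod volume) (volume.prod volume) := Measure.measurePreserving_swap
  have h := hs.comp (h2.comp (hs.comp (h1.comp hs)))
  have e : (wignerEquiv : (E × E) → (E × E)) = Prod.swap ∘ (fun z : E × E => (z.1, z.2 + z.1)) ∘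
      Prod.swap ∘ (fun z : E × E => (z.1, z.2 - (1 / 2 : ℝ) • z.1)) ∘ Prod.swap := by
    funext z
    change (z.1 + (1 / 2 : ℝ) • z.2, z.1 - (1 / 2 : ℝ) • z.2) = _
    ext <;> simp
    module
  rw [e]
  exact h

/-- The map taking the tensor product of `f` and `conj h` to the Wigner distribution of `f`
and `h`. -/
noncomputable def wignerMap (F : 𝓢(E × E, ℂ)) : 𝓢(E × E, ℂ) :=
  partialFourierSchwartz (SchwartzMap.compCLMOfContinuousLinearEquiv ℂ wignerEquiv F)

theorem wignerMap_surjective : Function.Surjective (wignerMap (E := E)) := fun Ψ => by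
  obtain ⟨G, rfl⟩ := partialFourierSchwartz_surjective Ψ
  refine ⟨SchwartzMap.compCLMOfContinuousLinearEquiv ℂ wignerEquiv.symm G, ?_⟩
  rw [wignerMap]
  congr 1
  ext z
  simp

theorem wigner_eq_wignerMap (f h : 𝓢(E, ℂ)) : wigner f h = wignerMap (tensor f (conj h)) :=
  SchwartzMap.ext fun z => congrFun (wignerFun_eq f h) z

theorem integral_conj_wignerMap_mul (F G : 𝓢(E × E, ℂ)) :
    ∫ z, starRingEnd ℂ (wignerMap F z) * wignerMap G z = ∫ z, starRingEnd ℂ (F z) * G z := by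
  rw [wignerMap, wignerMap, integral_conj_partialFourier_mul]
  exact measurePreserving_wignerEquiv.integral_comp
    wignerEquiv.toHomeomorph.measurableEmbedding fun z => starRingEnd ℂ (F z) * G z

theorem inner_toLp (F G : 𝓢(E × E, ℂ)) :
    inner ℂ (F.toLp 2) (G.toLp 2) = ∫ z, starRingEnd ℂ (F z) * G z := by
  have h := SchwartzMap.inner_toL2_toL2_eq F G (volume : Measure (E × E))
  simpa only [RCLike.inner_apply, mul_comm] using h

theorem lintegral_enorm_sq_schwartz {D : Type} [NormedAddCommGroup D] [NormedSpace ℝ D]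
    [FiniteDimensional ℝ D] [MeasurableSpace D] [BorelSpace D] {μ : Measure D}
    [μ.HasTemperateGrowth] (F : 𝓢(D, ℂ)) :
    ∫⁻ z, ‖F z‖ₑ ^ 2 ∂μ = ENNReal.ofReal (∫ z, starRingEnd ℂ (F z) * F z ∂μ).re := by
  have h : ∀ z, starRingEnd ℂ (F z) * F z = ((‖F z‖ ^ 2 : ℝ) : ℂ) := fun z => by
    rw [RCLike.conj_mul]; simp
  have hi := integrable_conj_mul (μ := μ) F F
  simp_rw [h] at hi ⊢
  rw [integral_complex_ofReal, Complex.ofReal_re, ofReal_integral_eq_lintegral_ofReal]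
  · congr 1
    funext z
    rw [ENNReal.ofReal_pow (norm_nonneg _), ofReal_norm]
  · exact hi.re
  · exact Filter.Eventually.of_forall fun z => by positivity

/-! ### Tight frame identities in d and 2d variables. -/

section Frame

variable {g : 𝓢(E, ℂ)} {Λ : Submodule ℤ (E × E)}

/-- In extended nonnegative form, sums and integrals can later be exchanged without summability
conditions. -/
theorem IsTightGaborFrame.tsum_enorm_sq (hg : IsTightGaborFrame g Λ) {f : E → ℂ}
    (hf : MemLp f 2) :
    ∑' l : Λ, ‖∫ t, starRingEnd ℂ (timeFreqShift (l : E × E) g t) * f t‖ₑ ^ 2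
      = ∫⁻ t, ‖f t‖ₑ ^ 2 := by
  have h := hg (hf.toLp f)
  have hin : ∀ l : Λ, inner ℂ ((timeFreqShift (l : E × E) g).toLp 2) (hf.toLp f)
      = ∫ t, starRingEnd ℂ (timeFreqShift (l : E × E) g t) * f t := fun l => by
    rw [L2.inner_def]
    refine integral_congr_ae ?_
    filter_upwards [(timeFreqShift (l : E × E) g).coeFn_toLp 2, hf.coeFn_toLp] with t h1 h2
    rw [h1, h2, RCLike.inner_apply, mul_comm]
  simp only [hin] at h
  have h1 := ENNReal.ofReal_tsum_of_nonneg (fun l => by positivity) h.summable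
  rw [h.tsum_eq] at h1
  simp only [ENNReal.ofReal_pow (norm_nonneg _), ofReal_norm] at h1
  rw [← h1, Lp.enorm_toLp]
  have := eLpNorm_nnreal_pow_eq_lintegral (f := f) (μ := volume) (p := 2) two_ne_zero
  simpa using this

/-- The frame identity is used twice: in `x` for each fixed `y`, which after integration gives the
total mass of the partial coefficients `φ l`, and then in `y` for the conjugate of each `φ l`. -/
theorem IsTightGaborFrame.tsum_tensor (hg : IsTightGaborFrame g Λ) [Countable Λ]
    (F : 𝓢(E × E, ℂ)) :
    ∑' p : Λ × Λ, ‖∫ z, starRingEnd ℂ (tensor (timeFreqShift (p.1 : E × E) g)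
      (conj (timeFreqShift (p.2 : E × E) g)) z) * F z‖ₑ ^ 2 = ∫⁻ z, ‖F z‖ₑ ^ 2 := by
  set φ : Λ → E → ℂ := fun l y =>
    ∫ x, starRingEnd ℂ (timeFreqShift (l : E × E) g x) * F (x, y) with hφ
  have hm : ∀ l, AEStronglyMeasurable (φ l) := fun l => by
    have : AEStronglyMeasurable (fun z : E × E =>
        starRingEnd ℂ (timeFreqShift (l : E × E) g z.2) * F (z.2, z.1))
        ((volume : Measure E).prod (volume : Measure E)) :=
      Continuous.aestronglyMeasurable (by fun_prop)
    exact this.integral_prod_right'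
  have hsec : ∀ y : E, ∑' l : Λ, ‖φ l y‖ₑ ^ 2 = ∫⁻ x, ‖F (x, y)‖ₑ ^ 2 := fun y => by
    refine hg.tsum_enorm_sq (f := fun x => F (x, y)) ?_
    exact (sectionMap (SchwartzMap.compCLMOfContinuousLinearEquiv ℂ
      (ContinuousLinearEquiv.prodComm ℝ E E) F) y).memLp 2
  have htot : ∑' l : Λ, ∫⁻ y, ‖φ l y‖ₑ ^ 2 = ∫⁻ z, ‖F z‖ₑ ^ 2 := by
    rw [← lintegral_tsum fun l => (hm l).enorm.pow_const 2, Measure.volume_eq_prod,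
      lintegral_prod_symm _ (F.continuous.enorm.measurable.pow_const 2).aemeasurable]
    exact lintegral_congr hsec
  have hfin : ∫⁻ z, ‖F z‖ₑ ^ 2 ≠ ⊤ := by
    rw [lintegral_enorm_sq_schwartz]; exact ENNReal.ofReal_ne_top
  have hmem : ∀ l, MemLp (fun y => starRingEnd ℂ (φ l y)) 2 := fun l => by
    refine ⟨Complex.continuous_conj.comp_aestronglyMeasurable (hm l), ?_⟩
    rw [eLpNorm_lt_top_iff_lintegral_rpow_enorm_lt_top two_ne_zero ENNReal.ofNat_ne_top]
    simp only [ENNReal.toReal_ofNat, ENNReal.rpow_ofNat, RCLike.enorm_conj]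
    exact ((ENNReal.le_tsum l).trans_eq htot).trans_lt hfin.lt_top
  rw [ENNReal.tsum_prod', ← htot]
  congr 1
  funext l
  have := hg.tsum_enorm_sq (hmem l)
  simp only [RCLike.enorm_conj] at this
  rw [← this]
  congr 1
  funext m
  congr 1
  have e : ∫ z, starRingEnd ℂ (tensor (timeFreqShift (l : E × E) g)
      (conj (timeFreqShift (m : E × E) g)) z) * F z
        = ∫ y, timeFreqShift (m : E × E) g y * φ l y := by
    have hi := integrable_conj_mul (μ := (volume : Measure (E × E)))
      (tensor (timeFreqShift (l : E × E) g) (conj (timeFreqShift (m : E × E) g))) F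
    rw [Measure.volume_eq_prod] at hi ⊢
    rw [integral_prod_symm _ hi]
    congr 1
    funext y
    rw [hφ, ← integral_const_mul]
    congr 1
    funext x
    change starRingEnd ℂ (timeFreqShift (l : E × E) g x *
      starRingEnd ℂ (timeFreqShift (m : E × E) g y)) * F (x, y) = _
    rw [map_mul, RCLike.conj_conj]
    ring
  rw [e, ← RCLike.enorm_conj, ← integral_conj]
  simp

/-- The atoms form a tight frame on phase space. -/
theorem IsTightGaborFrame.hasSum_atom (hg : IsTightGaborFrame g Λ) [Countable Λ]
    (Ψ : 𝓢(E × E, ℂ)) :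
    HasSum (fun p : Λ × Λ => ‖inner ℂ ((atom g (p.1 : E × E) p.2).toLp 2) (Ψ.toLp 2)‖ ^ 2)
      (‖Ψ.toLp 2‖ ^ 2) := by
  obtain ⟨F, rfl⟩ := wignerMap_surjective Ψ
  have h := hg.tsum_tensor F
  have hfin : ∫⁻ z, ‖F z‖ₑ ^ 2 ≠ ⊤ := by
    rw [lintegral_enorm_sq_schwartz]; exact ENNReal.ofReal_ne_top
  have h1 := ENNReal.hasSum_toReal (h.trans_ne hfin)
  rw [← ENNReal.tsum_toReal_eq fun p => by finiteness, h] at h1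
  have h2 : (∫⁻ z, ‖F z‖ₑ ^ 2).toReal = ‖(wignerMap F).toLp 2‖ ^ 2 := by
    rw [lintegral_enorm_sq_schwartz, ← integral_conj_wignerMap_mul,
      ← inner_toLp]
    rw [← inner_self_eq_norm_sq (𝕜 := ℂ)]
    exact ENNReal.toReal_ofReal (inner_self_nonneg (𝕜 := ℂ))
  rw [h2] at h1
  refine h1.congr_fun fun p => ?_
  rw [ENNReal.toReal_pow, toReal_enorm, ← integral_conj_wignerMap_mul, ← wigner_eq_wignerMap,
    inner_toLp]
  rfl

end Frame

/-- Polarization of the tight frame identity. -/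
theorem hasSum_inner_mul_inner {H ι : Type} [NormedAddCommGroup H] [InnerProductSpace ℂ H]
    {S : Submodule ℂ H} {w : ι → H}
    (h : ∀ v ∈ S, HasSum (fun i => ‖inner ℂ (w i) v‖ ^ 2) (‖v‖ ^ 2)) {u v : H}
    (hu : u ∈ S) (hv : v ∈ S) :
    HasSum (fun i => inner ℂ u (w i) * inner ℂ (w i) v) (inner ℂ u v) := by
  have h' : ∀ x ∈ S, HasSum (fun i => ((‖inner ℂ (w i) x‖ : ℂ)) ^ 2) ((‖x‖ : ℂ) ^ 2) :=
    fun x hx => by exact_mod_cast Complex.hasSum_ofReal.2 (h x hx)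
  have hIv : (RCLike.I : ℂ) • v ∈ S := S.smul_mem _ hv
  have h1 := (h' _ (S.add_mem hu hv)).sub (h' _ (S.sub_mem hu hv))
  have h2 := (h' _ (S.sub_mem hu hIv)).sub (h' _ (S.add_mem hu hIv))
  have h3 := (h1.add (h2.mul_right (RCLike.I : ℂ))).div_const 4
  -- The same polarization formula is applied to `u`, `v` and to their scalar coefficients, so the
  -- four square-sum identities combine term by term.
  rw [inner_eq_sum_norm_sq_div_four u v]
  refine h3.congr_fun fun i => ?_
  have := inner_eq_sum_norm_sq_div_four (𝕜 := ℂ) (inner ℂ (w i) u) (inner ℂ (w i) v)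
  rw [RCLike.inner_apply, inner_conj_symm] at this
  rw [mul_comm, this]
  simp only [inner_add_right, inner_sub_right, inner_smul_right, smul_eq_mul]
  rfl

/-! ### Synthesis of a symbol from a matrix with off-diagonal decay. -/

variable {Λ : Submodule ℤ (E × E)}

/-- Rapid decay of a matrix away from the diagonal. -/
def HasOffDiagonalDecay (m : Λ × Λ → ℂ) : Prop :=
  ∀ N : ℕ, ∃ C : ℝ, 0 ≤ C ∧ ∀ p : Λ × Λ, ‖m p‖ ≤ C * ((1 + ‖(p.1 : E × E) - p.2‖) ^ N)⁻¹

/-- The symbol with Gabor matrix `m`. -/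
noncomputable def gaborSymbol (g : 𝓢(E, ℂ)) (m : Λ × Λ → ℂ) (u : E × E) : ℂ :=
  ∑' p : Λ × Λ, m p * atom g (p.1 : E × E) p.2 u

section Symbol

variable [DiscreteTopology Λ] [IsZLattice ℝ Λ] {m : Λ × Λ → ℂ}

theorem exists_term_bound (g : 𝓢(E, ℂ)) (hm : HasOffDiagonalDecay m) (n K : ℕ) :
    ∃ C : ℝ, 0 ≤ C ∧ ∀ (p : Λ × Λ) (u : E × E),
      ‖iteratedFDeriv ℝ n (fun u => m p * atom g (p.1 : E × E) p.2 u) u‖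
        ≤ C * (((1 + ‖u - p.1‖) ^ K)⁻¹ * ((1 + ‖u - p.2‖) ^ K)⁻¹) := by
  -- The power `n` pays for differentiating the modulation; the power `2 * K` is what
  -- `weight_mul_weight_le` needs for two weights of order `K`.
  obtain ⟨A, hA, hmA⟩ := hm (2 * K + n)
  obtain ⟨B, hB, hatom⟩ := exists_atom_bound g n (2 * K)
  refine ⟨A * B, by positivity, fun p u => ?_⟩
  have hs : iteratedFDeriv ℝ n (fun u => m p * atom g (p.1 : E × E) p.2 u) u
      = m p • iteratedFDeriv ℝ n (atom g (p.1 : E × E) p.2) u := by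
    change iteratedFDeriv ℝ n (m p • ⇑(atom g (p.1 : E × E) p.2)) u = _
    exact iteratedFDeriv_const_smul_apply ((atom g (p.1 : E × E) p.2).contDiffAt n)
  rw [hs, norm_smul, ← mul_inv, ← div_eq_mul_inv, le_div_iff₀ (by positivity), ← mul_pow]
  have h1 := hmA p
  have h2 := hatom p.1 p.2 u
  rw [← div_eq_mul_inv, le_div_iff₀ (by positivity)] at h1
  have hw := weight_mul_weight_le u (p.1 : E × E) p.2
  set X := 1 + ‖u - (1 / 2 : ℝ) • ((p.1 : E × E) + p.2)‖
  set Y := 1 + ‖(p.1 : E × E) - p.2‖ with hY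
  have hX0 : 0 ≤ X := by positivity
  have hY0 : 0 < Y := by positivity
  set D := ‖iteratedFDeriv ℝ n (atom g (p.1 : E × E) p.2) u‖
  refine le_of_mul_le_mul_right ?_ (pow_pos hY0 n)
  calc ‖m p‖ * D * ((1 + ‖u - p.1‖) * (1 + ‖u - p.2‖)) ^ K * Y ^ n
      ≤ ‖m p‖ * D * ((X * Y) ^ 2) ^ K * Y ^ n := by gcongr
    _ = (‖m p‖ * Y ^ (2 * K + n)) * (X ^ (2 * K) * D) := by
        rw [← pow_mul, mul_pow, pow_add]; ring
    _ ≤ A * (B * Y ^ n) := by gcongr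
    _ = _ := by ring

theorem summable_weight_prod {K : ℕ} (hK : Module.finrank ℝ (E × E) + 1 ≤ K) (u : E × E) :
    Summable fun p : Λ × Λ => ((1 + ‖u - p.1‖) ^ K)⁻¹ * ((1 + ‖u - p.2‖) ^ K)⁻¹ := by
  obtain ⟨C, h⟩ := exists_lattice_sum_bound Λ hK
  obtain ⟨f, hf⟩ : ∃ f : Λ → ℝ, f = fun l : Λ => ((1 + ‖u - l‖) ^ K)⁻¹ := ⟨_, rfl⟩
  have h0 : 0 ≤ f := fun l => by
    rw [hf]
    exact inv_nonneg.2 (pow_nonneg (add_nonneg zero_le_one (norm_nonneg _)) _)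
  have hs : Summable f := hf ▸ (h u).1
  have := hs.mul_of_nonneg hs h0 h0
  rw [hf] at this
  exact this

theorem hasLocalSummableBound_gaborSymbol (g : 𝓢(E, ℂ)) (hm : HasOffDiagonalDecay m) (n : ℕ) :
    HasLocalSummableBound (fun (p : Λ × Λ) (u : E × E) => m p * atom g (p.1 : E × E) p.2 u) n := by
  intro u₀
  set K := Module.finrank ℝ (E × E) + 1
  obtain ⟨C, hC, h⟩ := exists_term_bound g hm n K
  -- Moving the centre from `u` to `u₀` within the unit ball changes each weight by a factor of at
  -- most 2^K.
  refine ⟨_, (summable_weight_prod (Λ := Λ) (K := K) le_rfl u₀).mul_left (C * (2 ^ K * 2 ^ K)),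
    fun p u hu => (h p u).trans ?_⟩
  have hw : ∀ v : E × E, ((1 + ‖u - v‖) ^ K)⁻¹ ≤ 2 ^ K * ((1 + ‖u₀ - v‖) ^ K)⁻¹ := fun v => by
    rw [← div_eq_mul_inv, inv_le_iff_one_le_mul₀ (by positivity), div_mul_eq_mul_div,
      le_div_iff₀ (by positivity), one_mul, ← mul_pow]
    gcongr
    have h1 := one_add_norm_add_le (u₀ - u) (u - v)
    rw [sub_add_sub_cancel] at h1
    have h2 : ‖u₀ - u‖ ≤ 1 := by
      rw [← dist_eq_norm, dist_comm]; exact (Metric.mem_ball.1 hu).le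
    refine h1.trans ?_
    gcongr
    linarith
  calc _ ≤ C * ((2 ^ K * ((1 + ‖u₀ - p.1‖) ^ K)⁻¹) * (2 ^ K * ((1 + ‖u₀ - p.2‖) ^ K)⁻¹)) := by
        gcongr <;> exact hw _
    _ = _ := by ring

theorem contDiff_term (g : 𝓢(E, ℂ)) (p : Λ × Λ) :
    ContDiff ℝ ∞ fun u => m p * atom g (p.1 : E × E) p.2 u :=
  contDiff_const.mul ((atom g (p.1 : E × E) p.2).smooth ⊤)

theorem isHormanderFun_gaborSymbol (g : 𝓢(E, ℂ)) (hm : HasOffDiagonalDecay m) :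
    IsHormanderFun (gaborSymbol g m) := by
  have key := fun n => contDiff_tsum_of_hasLocalSummableBound n (contDiff_term g)
    (hasLocalSummableBound_gaborSymbol g hm)
  refine ⟨contDiff_infty.2 fun n => (key n).1, fun n => ?_⟩
  set K := Module.finrank ℝ (E × E) + 1
  obtain ⟨A, hA, h⟩ := exists_term_bound g hm n K
  obtain ⟨B, hB⟩ := exists_lattice_sum_bound Λ (K := K) le_rfl
  refine ⟨A * (B * B), fun u => ((key n).2 u).trans ?_⟩
  have hs := summable_weight_prod (Λ := Λ) (K := K) le_rfl u
  refine (Summable.tsum_le_tsum (fun p => h p u)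
    ((hasLocalSummableBound_gaborSymbol g hm n).summable u) (hs.mul_left A)).trans ?_
  rw [tsum_mul_left, ← (hB u).1.tsum_mul_tsum (hB u).1 hs]
  have h0 : 0 ≤ ∑' l : Λ, ((1 + ‖u - l‖) ^ K)⁻¹ := tsum_nonneg fun _ => by positivity
  have := (hB u).2
  gcongr
  exact h0.trans this

/-- Sum and integral may be exchanged because the L¹ norms of the terms are summable: Ψ supplies
decay in the midpoint and `m` supplies decay in the difference. -/
theorem hasSum_integral_gaborSymbol [Countable Λ] (g : 𝓢(E, ℂ)) (hm : HasOffDiagonalDecay m)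
    (Ψ : 𝓢(E × E, ℂ)) :
    HasSum (fun p : Λ × Λ => m p * ∫ u, atom g (p.1 : E × E) p.2 u * Ψ u)
      (∫ u, gaborSymbol g m u * Ψ u) := by
  set K := Module.finrank ℝ (E × E) + 1
  obtain ⟨A, hA, hmA⟩ := hm (2 * K)
  obtain ⟨B, hB⟩ := exists_integral_norm_atom_mul_bound g Ψ (2 * K)
  have hint : ∀ p : Λ × Λ, Integrable fun u => m p * (atom g (p.1 : E × E) p.2 u * Ψ u) :=
    fun p => by
      have := integrable_conj_mul (μ := (volume : Measure (E × E)))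
        (conj (atom g (p.1 : E × E) p.2)) Ψ
      simp only [conj_apply, RCLike.conj_conj] at this
      exact this.const_mul _
  have hs : Summable fun p : Λ × Λ => ∫ u, ‖m p * (atom g (p.1 : E × E) p.2 u * Ψ u)‖ := by
    refine ((summable_weight_prod (Λ := Λ) (K := K) le_rfl 0).mul_left (A * B)).of_nonneg_of_le
      (fun p => integral_nonneg fun _ => norm_nonneg _) fun p => ?_
    simp only [norm_mul]
    rw [integral_const_mul, ← mul_inv, ← div_eq_mul_inv, le_div_iff₀ (by positivity), ← mul_pow]
    have h1 := hmA p
    have h2 := hB p.1 p.2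
    rw [← div_eq_mul_inv, le_div_iff₀ (by positivity)] at h1
    have hw := weight_mul_weight_le 0 (p.1 : E × E) p.2
    rw [zero_sub (_ • _), norm_neg] at hw
    set X := 1 + ‖(1 / 2 : ℝ) • ((p.1 : E × E) + p.2)‖
    set Y := 1 + ‖(p.1 : E × E) - p.2‖
    have hX0 : 0 ≤ X := by positivity
    have hY0 : 0 ≤ Y := by positivity
    set J := ∫ u, ‖atom g (p.1 : E × E) p.2 u‖ * ‖Ψ u‖
    have hJ : 0 ≤ J := integral_nonneg fun _ => by positivity
    calc ‖m p‖ * J * ((1 + ‖0 - (p.1 : E × E)‖) * (1 + ‖0 - (p.2 : E × E)‖)) ^ K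
        ≤ ‖m p‖ * J * ((X * Y) ^ 2) ^ K := by gcongr
      _ = (‖m p‖ * Y ^ (2 * K)) * (X ^ (2 * K) * J) := by rw [← pow_mul, mul_pow]; ring
      _ ≤ A * B := by gcongr
  have h := hasSum_integral_of_summable_integral_norm hint hs
  simp only [integral_const_mul] at h
  have e : ∀ u, ∑' p : Λ × Λ, m p * (atom g (p.1 : E × E) p.2 u * Ψ u)
      = gaborSymbol g m u * Ψ u := fun u => by
    simp only [gaborSymbol, ← tsum_mul_right, mul_assoc]
  simpa only [e] using h

end Symbol

/-! ### Atomic expansion of Schwartz functions and recovery of the symbol. -/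

section Expansion

variable [DiscreteTopology Λ] [IsZLattice ℝ Λ] [Countable Λ] {g : 𝓢(E, ℂ)}

/-- The coefficients of `Ψ` with respect to the atoms. -/
noncomputable def coeff (g : 𝓢(E, ℂ)) (Ψ : 𝓢(E × E, ℂ)) (p : Λ × Λ) : ℂ :=
  ∫ u, starRingEnd ℂ (atom g (p.1 : E × E) p.2 u) * Ψ u

theorem hasOffDiagonalDecay_coeff (g : 𝓢(E, ℂ)) (Ψ : 𝓢(E × E, ℂ)) :
    HasOffDiagonalDecay (coeff g Ψ : Λ × Λ → ℂ) := fun N => by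
  obtain ⟨C, hC, h⟩ := exists_coeff_bound g Ψ N
  refine ⟨C, hC, fun p => (h p.1 p.2).trans ?_⟩
  rw [← mul_inv, ← mul_pow]
  gcongr
  exact one_add_norm_sub_le _ _

/-- The polarized frame identity gives the expansion only weakly, tested against smooth functions of
compact support. The sum is a continuous function, so equality almost everywhere is equality at
every point. -/
theorem IsTightGaborFrame.hasSum_atom_apply (hg : IsTightGaborFrame g Λ) (Ψ : 𝓢(E × E, ℂ))
    (u : E × E) : HasSum (fun p : Λ × Λ => coeff g Ψ p * atom g (p.1 : E × E) p.2 u) (Ψ u) := by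
  have hd : HasOffDiagonalDecay (coeff g Ψ : Λ × Λ → ℂ) := hasOffDiagonalDecay_coeff g Ψ
  have hs : Summable fun p : Λ × Λ => coeff g Ψ p * atom g (p.1 : E × E) p.2 u :=
    .of_norm (by simpa using (hasLocalSummableBound_gaborSymbol g hd 0).summable u)
  have hcont : Continuous (gaborSymbol g (coeff g Ψ : Λ × Λ → ℂ)) :=
    (isHormanderFun_gaborSymbol g hd).1.continuous
  have hae : ∀ᵐ u : E × E, gaborSymbol g (coeff g Ψ : Λ × Λ → ℂ) u = Ψ u := by
    refine ae_eq_of_integral_contDiff_smul_eq hcont.locallyIntegrable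
      Ψ.continuous.locallyIntegrable fun θ hθ hθc => ?_
    let Θ : 𝓢(E × E, ℂ) := (hθc.comp_left Complex.ofReal_zero).toSchwartzMap
      (Complex.ofRealCLM.contDiff.comp hθ)
    have hΘ : ∀ u, Θ u = (θ u : ℂ) := fun u => rfl
    have hΘc : ∀ u, starRingEnd ℂ (Θ u) = Θ u := fun u => by rw [hΘ, Complex.conj_ofReal]
    have h1 := hasSum_integral_gaborSymbol g hd Θ
    -- Polarization takes place inside the subspace of Schwartz classes in L², where the frame
    -- identity for atoms is available.
    have h2 := hasSum_inner_mul_inner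
      (S := LinearMap.range (SchwartzMap.toLpCLM ℂ ℂ 2 (volume : Measure (E × E))).toLinearMap)
      (w := fun p : Λ × Λ => (atom g (p.1 : E × E) p.2).toLp 2)
      (by rintro _ ⟨F, rfl⟩; exact hg.hasSum_atom F) (u := Θ.toLp 2) (v := Ψ.toLp 2)
      ⟨Θ, rfl⟩ ⟨Ψ, rfl⟩
    simp only [inner_toLp, hΘc] at h2
    have h3 : ∫ u, gaborSymbol g (coeff g Ψ : Λ × Λ → ℂ) u * Θ u = ∫ u, Θ u * Ψ u := by
      refine h1.unique ?_
      refine h2.congr_fun fun p => ?_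
      rw [mul_comm]
      simp only [mul_comm (Θ _)]
      rfl
    simp only [Complex.real_smul, ← hΘ]
    rw [← h3]
    simp only [mul_comm]
  have heq := (hcont.ae_eq_iff_eq volume Ψ.continuous).1 hae
  rw [← heq]
  exact hs.hasSum

/-- The expansion of a Schwartz function on phase space into atoms. -/
theorem IsTightGaborFrame.hasSum_schwartz_atom (hg : IsTightGaborFrame g Λ) (Ψ : 𝓢(E × E, ℂ)) :
    HasSum (fun p : Λ × Λ => coeff g Ψ p • atom g (p.1 : E × E) p.2) Ψ := by
  refine hasSum_schwartz (fun u => hg.hasSum_atom_apply Ψ u) fun k n => ?_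
  set K := Module.finrank ℝ (E × E) + 1
  obtain ⟨A, hA, hatom⟩ := exists_atom_bound g n k
  -- The seminorm of order (k, n) of an atom grows at most like W^(n+k); the remaining power `K`
  -- ensures summability over Λ × Λ.
  obtain ⟨B, hB, hc⟩ := exists_coeff_bound g Ψ (n + k + K)
  refine ((summable_weight_prod (Λ := Λ) (K := K) le_rfl 0).mul_left (B * A)).of_nonneg_of_le
    (fun p => apply_nonneg _ _) fun p => ?_
  rw [map_smul_eq_mul]
  have h1 := hc p.1 p.2
  set W := (1 + ‖(p.1 : E × E)‖) * (1 + ‖(p.2 : E × E)‖) with hW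
  have hW0 : 0 < W := by positivity
  have hx : 1 + ‖(1 / 2 : ℝ) • ((p.1 : E × E) + p.2)‖ ≤ W := by
    refine le_trans ?_ (one_add_norm_add_le _ _)
    rw [norm_smul]
    norm_num
    linarith [norm_nonneg ((p.1 : E × E) + p.2)]
  have hsem : SchwartzMap.seminorm ℂ k n (atom g (p.1 : E × E) p.2) ≤ A * W ^ (n + k) := by
    refine SchwartzMap.seminorm_le_bound ℂ k n _ (by positivity) fun u => ?_
    have h2 := hatom p.1 p.2 u
    set x := (1 / 2 : ℝ) • ((p.1 : E × E) + p.2)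
    set D := ‖iteratedFDeriv ℝ n (atom g (p.1 : E × E) p.2) u‖
    have hu : ‖u‖ ≤ (1 + ‖u - x‖) * (1 + ‖x‖) := by
      have := one_add_norm_add_le (u - x) x
      rw [sub_add_cancel] at this
      linarith
    calc ‖u‖ ^ k * D ≤ ((1 + ‖u - x‖) * (1 + ‖x‖)) ^ k * D := by gcongr
      _ = (1 + ‖x‖) ^ k * ((1 + ‖u - x‖) ^ k * D) := by rw [mul_pow]; ring
      _ ≤ W ^ k * (A * W ^ n) := by
        refine mul_le_mul (by gcongr) (h2.trans ?_) (by positivity) (by positivity)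
        gcongr
        exact one_add_norm_sub_le _ _
      _ = _ := by ring
  simp only [zero_sub, norm_neg]
  change ‖coeff g Ψ p‖ ≤ _ at h1
  rw [← mul_inv, ← mul_pow, ← hW] at h1 ⊢
  calc _ ≤ B * (W ^ (n + k + K))⁻¹ * (A * W ^ (n + k)) := by gcongr
    _ = B * A * (W ^ K)⁻¹ := by
      rw [pow_add W (n + k) K]
      field_simp

/-- A tempered distribution whose Gabor matrix decays rapidly away from the diagonal belongs to
the Hörmander class. -/
theorem IsTightGaborFrame.isHormanderSymbol (hg : IsTightGaborFrame g Λ) {σ : 𝓢'(E × E, ℂ)}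
    (hσ : HasOffDiagonalDecay fun p : Λ × Λ => σ (conj (atom g (p.1 : E × E) p.2))) :
    IsHormanderSymbol σ := by
  set m := fun p : Λ × Λ => σ (conj (atom g (p.1 : E × E) p.2)) with hm
  have ha := isHormanderFun_gaborSymbol g hσ
  refine ⟨gaborSymbol g m, ha, ?_⟩
  refine ContinuousLinearMap.ext fun Ψ => ?_
  -- Since σ is linear and the matrix involves conjugated atoms, `conj Ψ` is expanded and the
  -- expansion conjugated. The conjugated coefficients are then the integrals of atom times Ψ.
  have h1 := ((SchwartzMap.postcompCLM (𝕜 := ℝ) (Complex.conjCLE : ℂ →L[ℝ] ℂ)).hasSum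
    (hg.hasSum_schwartz_atom (conj Ψ)))
  have hΨ : conj (conj Ψ) = Ψ := by ext u; simp
  have h2 : HasSum (fun p : Λ × Λ => σ (conj (coeff g (conj Ψ) p • atom g (p.1 : E × E) p.2)))
      (σ Ψ) := by
    have := h1.map σ σ.continuous
    change HasSum _ (σ (conj (conj Ψ))) at this
    rwa [hΨ] at this
  refine h2.unique ?_
  have h3 := hasSum_integral_gaborSymbol g hσ Ψ
  refine (toTemperedDistribution_apply ha Ψ).symm ▸ ?_
  simp only [mul_comm (Ψ _)]
  refine h3.congr_fun fun p => ?_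
  have e : conj (coeff g (conj Ψ) p • atom g (p.1 : E × E) p.2)
      = starRingEnd ℂ (coeff g (conj Ψ) p) • conj (atom g (p.1 : E × E) p.2) := by
    ext u; simp
  rw [e, map_smul, smul_eq_mul, mul_comm]
  congr 1
  rw [coeff, ← integral_conj]
  simp

end Expansion

end GaborWeyl

/-! ### The equivalence. -/

theorem mainTheorem9 (d : ℕ) (g : 𝓢(EuclideanSpace ℝ (Fin d), ℂ))
    (Λ : Submodule ℤ (EuclideanSpace ℝ (Fin d) × EuclideanSpace ℝ (Fin d)))
    [DiscreteTopology Λ] [IsZLattice ℝ Λ]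
    (hg : GaborWeyl.IsTightGaborFrame g Λ)
    (σ : 𝓢'(EuclideanSpace ℝ (Fin d) × EuclideanSpace ℝ (Fin d), ℂ)) :
    List.TFAE [
      GaborWeyl.IsHormanderSymbol σ,
      ∀ s : ℝ, 0 ≤ s → ∃ C : ℝ, ∀ z w : EuclideanSpace ℝ (Fin d) × EuclideanSpace ℝ (Fin d),
        ‖GaborWeyl.weylForm σ (GaborWeyl.timeFreqShift z g) (GaborWeyl.timeFreqShift w g)‖
          ≤ C * GaborWeyl.bracket (w - z) ^ (-s),
      ∀ s : ℝ, 0 ≤ s → ∃ C : ℝ, ∀ l ∈ Λ, ∀ m ∈ Λ,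
        ‖GaborWeyl.weylForm σ (GaborWeyl.timeFreqShift m g) (GaborWeyl.timeFreqShift l g)‖
          ≤ C * GaborWeyl.bracket (l - m) ^ (-s)] := by
  have : Countable Λ := TopologicalSpace.separableSpace_iff_countable.1 inferInstance
  tfae_have 1 → 2 := fun h s _ => h.exists_weylForm_bound g s
  tfae_have 2 → 3 := fun h s hs => by
    obtain ⟨C, hC⟩ := h s hs
    exact ⟨C, fun l _ m _ => hC m l⟩
  tfae_have 3 → 1 := fun h => by
    refine hg.isHormanderSymbol fun N => ?_
    obtain ⟨C, hC⟩ := h N (Nat.cast_nonneg N)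
    -- The absolute value supplies the sign required of the constant; 2^N comes from 1 + ‖ζ‖ ≤ 2⟨ζ⟩.
    refine ⟨|C| * 2 ^ N, by positivity, fun p => ?_⟩
    refine (hC p.1 p.1.2 p.2 p.2.2).trans ?_
    set ζ := (p.1 : EuclideanSpace ℝ (Fin d) × EuclideanSpace ℝ (Fin d)) - p.2
    have hb := GaborWeyl.one_le_bracket ζ
    rw [Real.rpow_neg (by linarith), Real.rpow_natCast, mul_assoc]
    gcongr
    · exact le_abs_self C
    · rw [← div_eq_mul_inv, inv_le_iff_one_le_mul₀ (by positivity), div_mul_eq_mul_div,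
        le_div_iff₀ (by positivity), one_mul, ← mul_pow]
      gcongr
      exact GaborWeyl.one_add_norm_le_bracket ζ
  tfae_finish
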